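/- Setting. Let $\{\varphi_i\}_{i\in\iota}$ be an orthonormal basis (arbitrary index set) of the one-particle Hilbert space $\mathcal H\cong\ell^2(\iota)$, let $a_i,a_i^\dagger$ be the bosonic annihilation and creation operators, and let $|\varphi_{i_1}\cdots\varphi_{i_N}\rangle=\frac1{\sqrt{N!}}a^\dagger_{i_1}\cdots a^\dagger_{i_N}|0\rangle$. An $N$-particle operator $A$ is represented by its matrix elements $A_{i_1\dots i_N;j_1\dots j_N}=\langle\varphi_{i_1}\cdots\varphi_{i_N}|A|\varphi_{j_1}\cdots\varphi_{j_N}\rangle$; products are formed with the completeness relation, an $S$-particle operator acts on $N$ particles as $\frac1{S!}\sum A_{k_1\dots k_S;l_1\dots l_S}a^\dagger_{k_1}\cdots a^\dagger_{k_S}a_{l_1}\cdots a_{l_S}$, and $$\mathrm{Tr}^{(N)}_{N-M}\{X\}=\tfrac{(N-M)!}{N!\,M!}\sum_{n_1\dots n_M,\,m_1\dots m_M}\mathrm{Tr}^{(N)}\{a^\dagger_{n_1}\cdots a^\dagger_{n_M}a_{m_1}\cdots a_{m_M}X\}\,a^\dagger_{m_1}\cdots a^\dagger_{m_M}a_{n_1}\cdots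 a_{n_M}.$$ Let $H=H^{(1)}+H^{(2)}=\sum H^{(1)}_{ij}a_i^\dagger a_j+\frac12\sum H^{(2)}_{ij;kl}a_i^\dagger a_j^\dagger a_ka_l$, where $H^{(1)}$ and $H^{(2)}$ are symmetric (possibly unbounded) operators on $\mathcal H$ and $\mathcal H\otimes\mathcal H$, $H^{(2)}_{ij;kl}=\langle\varphi_i\varphi_j|H^{(2)}|\varphi_k\varphi_l\rangle$, the $\varphi_i$ lie in $D(H^{(1)})$, and $f\vee g=\frac12(f\otimes g+g\otimes f)\in D(H^{(2)})$ for all $f,g\in D(H^{(1)})$. Let $\hbar>0$, $N\ge 0$, and let $\Phi(t)\in D(H^{(1)})$, $t\in\mathbb R$, be unit vectors. Assume the bosonic pure product state $\rho^{(N)}(t)=\frac1{N!}(a_{\Phi(t)}^\dagger)^N(a_{\Phi(t)})^N$, where $a^\dagger_\Phi|0\rangle=|\Phi\rangle$, and put $\rho^{(M)}(t)=\mathrm{Tr}^{(N)}_{N-M}\{\rho^{(N)}(t)\}$ and $$C^{(1)}(t)=\sum_{ijmn}H^{(2)}_{nj;im}\,\rho^{(1)}_{ij}(t)\,a_n^\dagger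 a_m .$$ Equations of motion for operators are understood for each matrix element. Claim. All series below converge (the one for $C^{(1)}_{nm}$ summed over $i$, then over $j$), and the following holds. (1) Closure. For $1\le M\le N$ and every $t$, $$[H^{(1)}+(1-(N-M))H^{(2)},\rho^{(M)}]+(N-M)\mathrm{Tr}^{(M+1)}_1\{[H^{(2)},\rho^{(M+1)}]\}=[H^{(1)}+H^{(2)}+(N-M)C^{(1)}(t),\rho^{(M)}(t)].$$ Hence the level-$M$ equation of the BBGKY hierarchy (that $i\hbar\partial_t\rho^{(M)}$ equals the left-hand side) holds at time $t$ if and only if $$i\hbar\,\partial_t\rho^{(M)}(t)=[H^{(1)}+H^{(2)}+(N-M)C^{(1)}(t),\rho^{(M)}(t)],\qquad(*)$$ and $(*)$ holds at time $t$ for every $1\le M\le N$ whenever $\rho^{(N)}$ satisfies the von Neumann equation $i\hbar\partial_t\rho^{(N)}=[H,\rho^{(N)}]$ at time $t$. (2) Case $M=1$, $N\ge1$. Then $\rho^{(1)}(t)=|\Phi(t)\rangle\langle\Phi(t)|$, and $(*)$ is equivalent, up to a global phase, to the nonlinear Schrödinger equation $$i\hbar\,\partial_t\Phi=\big(H^{(1)}+(N-1)C^{(1)}(t)\big)\Phi.\qquad(**)$$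 Precisely: if $\Phi$ satisfies $(**)$ at time $t$ (derivative in norm), then $(*)$ with $M=1$ holds at time $t$; and if $\Phi$ is $C^1$ in norm and $t\mapsto H^{(1)}\Phi(t)$, $t\mapsto H^{(2)}(\Phi(t)\vee\Phi(t))$ are continuous, then $(*)$ with $M=1$ holds for all $t$ if and only if there is a $C^1$ function $\theta:\mathbb R\to\mathbb R$ such that $e^{i\theta(t)}\Phi(t)$ satisfies $(**)$ for all $t$. -/

import Mathlib

open scoped Nat ComplexConjugate InnerProductSpace lp

noncomputable section

namespace BoseHierarchy

variable {ι : Type*}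

/-! ### Fock space, creation and annihilation operators of the modes `i : ι` -/

/-- The vectors of Fock space with finitely many particles in finitely many of the modes `i : ι`,
in the Bargmann representation: the vacuum is `1`, and the monomial `∏ i, X i ^ n i` is
`√(∏ i, (n i)!)` times the normalized state with occupation numbers `n`. -/
abbrev Fock (ι : Type*) := MvPolynomial ι ℂ

/-- The inner product of Fock space (conjugate linear in the first argument). -/
def fockInner (f g : Fock ι) : ℂ :=
  ∑ n ∈ f.support, conj (f.coeff n) * g.coeff n * (n.prod fun _ k => (k ! : ℂ))

/-- The vacuum `|0⟩`. -/
def vacuum : Fock ι := 1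

/-- The creation operator `a†_i`. -/
def create (i : ι) : Module.End ℂ (Fock ι) := LinearMap.mulLeft ℂ (MvPolynomial.X i)

/-- The annihilation operator `a_i`. -/
def annihilate (i : ι) : Module.End ℂ (Fock ι) := (MvPolynomial.pderiv i).toLinearMap

/-- The annihilation operator `a_Φ = ∑ i, conj (c i) a_i` of the one-particle state
`Φ = ∑ i, c i φ_i` (see `annihilateState_apply`). -/
def annihilateState (c : ι → ℂ) : Module.End ℂ (Fock ι) :=
  (MvPolynomial.mkDerivation ℂ fun i => MvPolynomial.C (conj (c i))).toLinearMap

/-- The canonical commutation relation `[a_i, a†_j] = δ_ij`. -/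
theorem annihilate_create [DecidableEq ι] (i j : ι) :
    annihilate i * create j - create j * annihilate i =
      if i = j then (1 : Module.End ℂ (Fock ι)) else 0 := by
  refine LinearMap.ext fun f => ?_
  by_cases h : i = j
  · subst h
    simp [annihilate, create]
  · have h' : j ≠ i := fun e => h e.symm
    simp [annihilate, create, h, MvPolynomial.pderiv_X_of_ne h']

/-- `a†_i` is adjoint to `a_i`. -/
theorem fockInner_create (i : ι) (f g : Fock ι) :
    fockInner (create i f) g = fockInner f (annihilate i g) := by
  classical
  have hfac : ∀ n : ι →₀ ℕ, ((Finsupp.single i 1 + n).prod fun _ k => (k ! : ℂ)) =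
      ((n i : ℂ) + 1) * (n.prod fun _ k => (k ! : ℂ)) := by
    intro n
    have hs : ∀ m : ι →₀ ℕ, m.support ⊆ insert i n.support →
        (m.prod fun _ k => (k ! : ℂ)) = ∏ x ∈ insert i n.support, ((m x)! : ℂ) := by
      intro m hm
      exact Finsupp.prod_of_support_subset m hm _ (by simp)
    rw [hs n (Finset.subset_insert _ _), hs (Finsupp.single i 1 + n) (by
      intro x hx
      by_cases hxi : x = i
      · simp [hxi]
      · simp_all [Ne.symm hxi, eq_comm])]
    rw [← Finset.mul_prod_erase _ _ (Finset.mem_insert_self i n.support),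
      ← Finset.mul_prod_erase _ (fun x => ((n x)! : ℂ)) (Finset.mem_insert_self i n.support),
      ← mul_assoc]
    congr 1
    · simp [add_comm 1, Nat.factorial_succ]
    · refine Finset.prod_congr rfl fun x hx => ?_
      have : i ≠ x := fun e => (Finset.mem_erase.1 hx).1 e.symm
      simp [this]
  unfold fockInner create annihilate
  rw [LinearMap.mulLeft_apply, mul_comm, MvPolynomial.support_mul_X, Finset.sum_map]
  refine Finset.sum_congr rfl fun n _ => ?_
  simp only [addRightEmbedding_apply, Derivation.coeFn_coe]
  rw [MvPolynomial.coeff_mul_X, MvPolynomial.coeff_pderiv, add_comm n, hfac]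
  ring

theorem annihilateState_apply (c : ι → ℂ) (f : Fock ι) :
    annihilateState c f = ∑ i ∈ f.vars, conj (c i) • annihilate i f := by
  classical
  have hco : ∀ (t : Finset ι) (g : Fock ι),
      (∑ i ∈ t, conj (c i) • MvPolynomial.pderiv (R := ℂ) i : Derivation ℂ (Fock ι) (Fock ι)) g =
        ∑ i ∈ t, conj (c i) • MvPolynomial.pderiv i g := by
    intro t g
    induction t using Finset.induction_on with
    | empty => simp
    | insert a t ha ih =>
      rw [Finset.sum_insert ha, Finset.sum_insert ha, Derivation.add_apply, ih,
        Derivation.smul_apply]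
  have key : (MvPolynomial.mkDerivation ℂ fun i => MvPolynomial.C (conj (c i))) f =
      (∑ i ∈ f.vars, conj (c i) • MvPolynomial.pderiv (R := ℂ) i :
        Derivation ℂ (Fock ι) (Fock ι)) f := by
    refine MvPolynomial.derivation_eq_of_forall_mem_vars fun j hj => ?_
    rw [MvPolynomial.mkDerivation_X, hco, Finset.sum_eq_single_of_mem j hj]
    · simp [MvPolynomial.smul_eq_C_mul]
    · intro i _ hij
      simp [MvPolynomial.pderiv_X_of_ne (Ne.symm hij)]
  rw [hco] at key
  exact key

/-- `a†_{k 0} a†_{k 1} ⋯`. -/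
def createMany {S : ℕ} (k : Fin S → ι) : Module.End ℂ (Fock ι) :=
  (List.ofFn fun s => create (k s)).prod

/-- `a_{l 0} a_{l 1} ⋯`. -/
def annihilateMany {S : ℕ} (l : Fin S → ι) : Module.End ℂ (Fock ι) :=
  (List.ofFn fun s => annihilate (l s)).prod

/-- The symmetrized state `|φ_{i 0} φ_{i 1} ⋯⟩ = (1/√N!) a†_{i 0} a†_{i 1} ⋯ |0⟩`. -/
def ket {N : ℕ} (i : Fin N → ι) : Fock ι :=
  ((Real.sqrt (N ! : ℝ) : ℝ) : ℂ)⁻¹ • createMany i vacuum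

/-! ### `N`-particle operators -/

/-- An `N`-particle operator `A`, given by its matrix elements
`A i j = ⟨φ_{i 0} φ_{i 1} ⋯ | A | φ_{j 0} φ_{j 1} ⋯⟩` between symmetrized states. -/
abbrev Op (ι : Type*) (N : ℕ) := (Fin N → ι) → (Fin N → ι) → ℂ

/-- The product of two operators, by the completeness relation
`∑ l, |φ_{l 0} φ_{l 1} ⋯⟩⟨φ_{l 0} φ_{l 1} ⋯| = 1` on the `N`-particle space. -/
def mulOp {N : ℕ} (A B : Op ι N) : Op ι N := fun i j => ∑' l, A i l * B l j

/-- The commutator `[A, B]`. -/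
def comm {N : ℕ} (A B : Op ι N) : Op ι N := mulOp A B - mulOp B A

/-- The `N`-particle trace `Tr^(N)`. -/
def trace {N : ℕ} (A : Op ι N) : ℂ := ∑' i, A i i

/-- `a†_{k 0} a†_{k 1} ⋯ a_{l 0} a_{l 1} ⋯` as an operator on the `N`-particle space. -/
def normalOrdered {S : ℕ} (k l : Fin S → ι) (N : ℕ) : Op ι N := fun i j =>
  fockInner (ket i) (createMany k (annihilateMany l (ket j)))

/-- The second quantization `(1/S!) ∑ A_{k;l} a†_{k 0} a†_{k 1} ⋯ a_{l 0} a_{l 1} ⋯` of the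
`S`-particle operator `A`, as an operator on the `N`-particle space. In each matrix element
only finitely many terms of the sum are different from zero. -/
def secondQuantized {S : ℕ} (A : Op ι S) (N : ℕ) : Op ι N := fun i j =>
  (S ! : ℂ)⁻¹ * ∑ᶠ p : (Fin S → ι) × (Fin S → ι), A p.1 p.2 * normalOrdered p.1 p.2 N i j

/-- The partial trace `Tr^(N)_{N-M}` over `N - M` of `N` bosons, an `M`-particle operator:
`((N-M)!/(N! M!)) ∑ Tr^(N){a†_{n 0} ⋯ a_{m 0} ⋯ X} a†_{m 0} ⋯ a_{n 0} ⋯`. -/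
def partialTrace (N M : ℕ) (X : Op ι N) : Op ι M :=
  secondQuantized
    (fun m n : Fin M → ι => ((N - M)! : ℂ) / (N ! : ℂ) * trace (mulOp (normalOrdered n m N) X)) M

/-- The bosonic pure product state `(1/N!) (a†_Φ)^N (a_Φ)^N` of `N` particles. -/
def pureProduct (N : ℕ) (c : ι → ℂ) : Op ι N := fun i j =>
  (N ! : ℂ)⁻¹ * fockInner ((annihilateState c ^ N) (ket i)) ((annihilateState c ^ N) (ket j))

/-! ### Hamiltonians -/

/-- The one-particle basis state `φ_i`; the one-particle Hilbert space is `ℓ²(ι, ℂ)`. -/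
def mode (i : ι) : ℓ²(ι, ℂ) := by
  classical exact lp.single 2 i (1 : ℂ)

/-- The symmetrized product `(f ⊗ g + g ⊗ f) / 2` of two one-particle states; the Hilbert space
`ℓ²(ι, ℂ) ⊗ ℓ²(ι, ℂ)` of two particles is `ℓ²(ι × ι, ℂ)`. -/
def pair (f g : ℓ²(ι, ℂ)) : ℓ²(ι × ι, ℂ) :=
  ⟨fun p => (f p.1 * g p.2 + g p.1 * f p.2) / 2, by
    have key : ∀ f g : ℓ²(ι, ℂ), Memℓp (fun p : ι × ι => f p.1 * g p.2) 2 := by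
      intro f g
      have h : ∀ u : ℓ²(ι, ℂ), Summable fun i => ‖u i‖ ^ (2 : ENNReal).toReal := fun u =>
        (memℓp_gen_iff (by norm_num)).1 (lp.memℓp u)
      refine (memℓp_gen_iff (by norm_num)).2 ?_
      have := (h f).mul_of_nonneg (h g) (fun _ => by positivity) (fun _ => by positivity)
      refine this.congr fun p => ?_
      rw [norm_mul, Real.mul_rpow (norm_nonneg _) (norm_nonneg _)]
    have := ((key f g).add (key g f)).const_smul (2⁻¹ : ℂ)
    have e : ((2⁻¹ : ℂ) • ((fun p : ι × ι => f p.1 * g p.2) + fun p : ι × ι => g p.1 * f p.2)) =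
        fun p : ι × ι => (f p.1 * g p.2 + g p.1 * f p.2) / 2 := by
      funext p
      simp [div_eq_inv_mul]
    exact e ▸ this⟩

/-- A Hamiltonian of bosons with pairwise interaction: symmetric, possibly unbounded operators
`H1` on the one-particle space (kinetic energy and external potential) and `H2` on the
two-particle space (interaction). The basis states lie in the domain of `H1`, and symmetrized
products of states from the domain of `H1` lie in the domain of `H2`. -/
structure Hamiltonian (ι : Type*) where
  H1 : ℓ²(ι, ℂ) →ₗ.[ℂ] ℓ²(ι, ℂ)
  H2 : ℓ²(ι × ι, ℂ) →ₗ.[ℂ] ℓ²(ι × ι, ℂ)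
  symm1 : ∀ f g : H1.domain, ⟪H1 f, (g : ℓ²(ι, ℂ))⟫_ℂ = ⟪(f : ℓ²(ι, ℂ)), H1 g⟫_ℂ
  symm2 : ∀ f g : H2.domain, ⟪H2 f, (g : ℓ²(ι × ι, ℂ))⟫_ℂ = ⟪(f : ℓ²(ι × ι, ℂ)), H2 g⟫_ℂ
  mode_mem : ∀ i, mode i ∈ H1.domain
  pair_mem : ∀ f ∈ H1.domain, ∀ g ∈ H1.domain, pair f g ∈ H2.domain

namespace Hamiltonian

variable (H : Hamiltonian ι)

/-- The matrix elements `H1_{ij} = ⟨φ_i| H1 |φ_j⟩`. -/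
def one : Op ι 1 := fun i j => ⟪mode (i 0), H.H1 ⟨mode (j 0), H.mode_mem _⟩⟫_ℂ

/-- The matrix elements `H2_{ij;kl} = ⟨φ_i φ_j| H2 |φ_k φ_l⟩`. -/
def two : Op ι 2 := fun i j =>
  ⟪pair (mode (i 0)) (mode (i 1)),
    H.H2 ⟨pair (mode (j 0)) (mode (j 1)), H.pair_mem _ (H.mode_mem _) _ (H.mode_mem _)⟩⟫_ℂ

/-- `H1 = ∑ H1_{ij} a†_i a_j` on the `M`-particle space. -/
def onePart (M : ℕ) : Op ι M := secondQuantized H.one M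

/-- `H2 = (1/2) ∑ H2_{ij;kl} a†_i a†_j a_k a_l` on the `M`-particle space. -/
def twoPart (M : ℕ) : Op ι M := secondQuantized H.two M

/-- The matrix elements `∑ H2_{nj;im} ρ_{ij}` of the mean-field potential for the one-particle
density operator `ρ`. -/
def meanField (ρ : Op ι 1) : Op ι 1 := fun n m =>
  ∑' j, ∑' i, H.two ![n 0, j] ![i, m 0] * ρ ![i] ![j]

/-- The mean-field potential `C = ∑ H2_{nj;im} ρ_{ij} a†_n a_m` on the `M`-particle space. -/
def meanFieldPart (ρ : Op ι 1) (M : ℕ) : Op ι M := secondQuantized (H.meanField ρ) M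

/-- The right-hand side `[H1 + H2, ρ]` of the von Neumann equation for `ρ`. -/
def vonNeumannRHS {N : ℕ} (ρ : Op ι N) : Op ι N := comm (H.onePart N + H.twoPart N) ρ

/-- The right-hand side of the equation for `ρ^(M) = Tr^(N)_{N-M}{ρ}` in the BBGKY hierarchy,
`[H1 + (1-(N-M)) H2, ρ^(M)] + (N-M) Tr^(M+1)_1{[H2, ρ^(M+1)]}`. -/
def bbgkyRHS {N : ℕ} (M : ℕ) (ρ : Op ι N) : Op ι M :=
  comm (H.onePart M + (1 - ((N : ℂ) - M)) • H.twoPart M) (partialTrace N M ρ) +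
    ((N : ℂ) - M) •
      partialTrace (M + 1) M (comm (H.twoPart (M + 1)) (partialTrace N (M + 1) ρ))

/-- The right-hand side `[H1 + H2 + (N-M) C, ρ^(M)]` of the truncated equation, where
`ρ^(M) = Tr^(N)_{N-M}{ρ}` and `C` is the mean-field potential of `ρ^(1)`. -/
def truncatedRHS {N : ℕ} (M : ℕ) (ρ : Op ι N) : Op ι M :=
  comm (H.onePart M + H.twoPart M +
    ((N : ℂ) - M) • H.meanFieldPart (partialTrace N 1 ρ) M) (partialTrace N M ρ)

/-- The effective one-particle Hamiltonian `H1 + (N-1) C`, where `C` is the mean-field potential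
of the one-particle state `|Φ⟩⟨Φ|`. -/
def effective (N : ℕ) (Φ : ι → ℂ) : Op ι 1 :=
  H.one + ((N : ℂ) - 1) • H.meanField fun i j => Φ (i 0) * conj (Φ (j 0))

/-- The curve `Φ` satisfies `iħ ∂Φ/∂t = (H1 + (N-1) C) Φ` at time `t`. -/
def SolvesNLS (N : ℕ) (ħ : ℝ) (Φ : ℝ → ℓ²(ι, ℂ)) (t : ℝ) : Prop :=
  ∃ Φ' : ℓ²(ι, ℂ), HasDerivAt Φ Φ' t ∧
    ∀ n, Complex.I * ħ * Φ' n = ∑' m, H.effective N (Φ t) ![n] ![m] * Φ t m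

end Hamiltonian

/-- The curve `ρ` of operators satisfies `iħ ∂ρ/∂t = R` at time `t`. -/
def EvolvesAt {M : ℕ} (ħ : ℝ) (ρ : ℝ → Op ι M) (t : ℝ) (R : Op ι M) : Prop :=
  ∀ i j, ∃ d : ℂ, HasDerivAt (fun s => ρ s i j) d t ∧ Complex.I * ħ * d = R i j

/-- All series in the matrix elements of the commutator `[A, B]` converge. -/
def CommConverges {M : ℕ} (A B : Op ι M) : Prop :=
  ∀ i j, (Summable fun l => A i l * B l j) ∧ Summable fun l => B i l * A l j

/-- All traces in the partial trace `Tr^(N)_{N-M}{X}` converge. -/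
def PartialTraceConverges (N M : ℕ) (X : Op ι N) : Prop :=
  ∀ m n : Fin M → ι, Summable fun i => mulOp (normalOrdered n m N) X i i

/-- The series defining the mean-field potential of `ρ` converges. -/
def Hamiltonian.MeanFieldConverges (H : Hamiltonian ι) (ρ : Op ι 1) : Prop :=
  ∀ n m : ι, (∀ j, Summable fun i => H.two ![n, j] ![i, m] * ρ ![i] ![j]) ∧
    Summable fun j => ∑' i, H.two ![n, j] ![i, m] * ρ ![i] ![j]

end BoseHierarchy

end

namespace BoseHierarchy

variable {ι : Type*}

/-! ### Fock space: monomials and their inner products -/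

/-! The pure product state has matrix elements `power c i * conj (power c j)` (`pureProduct_eq`): it
is the rank-one projection onto the product vector with components `power c`. Taking partial traces
only lowers its particle number. If a hermitian matrix sends a vector `u` to `v`, its commutator
with `u u*` is `v u* - u v*` (`commConverges_rankOne`). Every commutator is therefore determined by
the action of an operator on a product vector: one-particle operators act slot by slot (`lift₁`),
the interaction acts on pairs of slots (`lift₂`).

Closure. Contract the last slot of `H2` acting on `M + 1` particles with `conj c`. Pairs that avoid
this slot give `H2` on `M` particles. Pairs that contain it give the one-particle function
`meanAction`, which is also the image of `c` under the mean-field potential. Hence the traced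
commutator is `[H2 + C, ρ^(M)]` (`partialTrace_comm_twoPart`), and the coefficients `1 - (N-M)` and
`N-M` of `H2` add up to one.

Unboundedness. `H2` is only applied to symmetrized products of vectors in the domain of `H1`. By
symmetry it can be moved to a factor that stays fixed while the other factor is expanded in modes,
so each series is an expansion of an ordinary `ℓ²` inner product.

From von Neumann to level `M`. The equation holds only for each matrix element, so a time derivative
need not commute with an infinite trace. Instead, a formal derivative `e` of the one-particle state
is recovered from the matrix elements, and the equation becomes `iħ lift₁ e = (action of H) + a
power` with `a` real. Contracting slots one at a time gives the analogous equation at each lower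
level, with a coefficient whose imaginary part grows linearly in the number of contractions. At zero
particles this coefficient must vanish, so all of them are real and drop out of the commutators
(`exists_truncatedAction_eq`).

Nonlinear Schrödinger equation. At `M = 1` the same rank-one argument gives `iħ Φ' = (H1 + (N-1) C)
Φ + a Φ` with `a` real. An integrated phase removes `a`, and `C` does not see phases. -/

/-- The monomial `X (i 0) * X (i 1) * ⋯`. -/
noncomputable def mon {N : ℕ} (i : Fin N → ι) : Fock ι := ∏ s, MvPolynomial.X (i s)

theorem mon_succ {N : ℕ} (i : Fin (N + 1) → ι) :
    mon i = create (i 0) (mon fun s => i s.succ) := by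
  simp [mon, create, Fin.prod_univ_succ]

theorem mon_append {S K : ℕ} (k : Fin S → ι) (r : Fin K → ι) :
    mon (Fin.append k r) = mon k * mon r := by
  simp [mon, Fin.prod_univ_add]

theorem createMany_apply {S : ℕ} (k : Fin S → ι) (f : Fock ι) : createMany k f = mon k * f := by
  induction S with
  | zero => simp [createMany, mon]
  | succ S ih =>
    have := ih fun s => k s.succ
    unfold createMany at this ⊢
    rw [List.ofFn_succ, List.prod_cons, Module.End.mul_apply, this]
    simp [mon_succ k, create, mul_assoc]

theorem annihilateMany_succ {S : ℕ} (l : Fin (S + 1) → ι) (f : Fock ι) :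
    annihilateMany l f = annihilate (l 0) (annihilateMany (fun s => l s.succ) f) := by
  simp [annihilateMany, List.ofFn_succ]

theorem annihilate_comm (i j : ι) (f : Fock ι) :
    annihilate i (annihilate j f) = annihilate j (annihilate i f) := by
  have h : ⁅MvPolynomial.pderiv (R := ℂ) i, MvPolynomial.pderiv (R := ℂ) j⁆ = 0 := by
    classical
    refine MvPolynomial.derivation_ext fun k => ?_
    simp [Derivation.commutator_apply, MvPolynomial.pderiv_X, Pi.single_apply, apply_ite]
  have h' := congrArg (fun D => D f) h
  rw [Derivation.commutator_apply] at h'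
  exact sub_eq_zero.1 h'

theorem annihilateMany_annihilate {S : ℕ} (l : Fin S → ι) (i : ι) (f : Fock ι) :
    annihilateMany l (annihilate i f) = annihilate i (annihilateMany l f) := by
  induction S with
  | zero => simp [annihilateMany]
  | succ S ih => rw [annihilateMany_succ, annihilateMany_succ, ih, annihilate_comm]

theorem fockInner_eq_sum (f g : Fock ι) {s : Finset (ι →₀ ℕ)} (hs : f.support ⊆ s) :
    fockInner f g = ∑ n ∈ s, conj (f.coeff n) * g.coeff n * (n.prod fun _ k => (k ! : ℂ)) := by
  refine Finset.sum_subset hs fun n _ hn => ?_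
  simp [MvPolynomial.notMem_support_iff.1 hn]

theorem fockInner_conj (f g : Fock ι) : conj (fockInner f g) = fockInner g f := by
  classical
  rw [fockInner_eq_sum f g (Finset.subset_union_left (s₂ := g.support)),
    fockInner_eq_sum g f (Finset.subset_union_right (s₁ := f.support)), map_sum]
  refine Finset.sum_congr rfl fun n _ => ?_
  simp only [map_mul, Complex.conj_conj, Finsupp.prod, map_prod, map_natCast]
  ring

/-- The inner product as a linear functional of its second argument. -/
noncomputable def fockInnerₗ (f : Fock ι) : Fock ι →ₗ[ℂ] ℂ where
  toFun := fockInner f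
  map_add' g h := by
    simp [fockInner, mul_add, add_mul, Finset.sum_add_distrib]
  map_smul' a g := by
    simp only [fockInner, MvPolynomial.coeff_smul, smul_eq_mul, RingHom.id_apply, Finset.mul_sum]
    exact Finset.sum_congr rfl fun n _ => by ring

theorem fockInnerₗ_apply (f g : Fock ι) : fockInnerₗ f g = fockInner f g := rfl

theorem fockInner_smul_right (a : ℂ) (f g : Fock ι) :
    fockInner f (a • g) = a * fockInner f g := (fockInnerₗ f).map_smul a g

theorem fockInner_smul_left (a : ℂ) (f g : Fock ι) :
    fockInner (a • f) g = conj a * fockInner f g := by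
  rw [← fockInner_conj, fockInner_smul_right, map_mul, fockInner_conj]

theorem fockInner_sum_right {α : Type*} (s : Finset α) (f : Fock ι) (g : α → Fock ι) :
    fockInner f (∑ x ∈ s, g x) = ∑ x ∈ s, fockInner f (g x) := map_sum (fockInnerₗ f) g s

theorem fockInner_sum_left {α : Type*} (s : Finset α) (f : α → Fock ι) (g : Fock ι) :
    fockInner (∑ x ∈ s, f x) g = ∑ x ∈ s, fockInner (f x) g := by
  rw [← fockInner_conj, fockInner_sum_right, map_sum]
  exact Finset.sum_congr rfl fun x _ => fockInner_conj _ _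

theorem eq_zero_of_fockInner_self (f : Fock ι) (h : fockInner f f = 0) : f = 0 := by
  have h' : ∑ n ∈ f.support, ‖f.coeff n‖ ^ 2 * (n.prod fun _ k => (k ! : ℝ)) = 0 := by
    have : ((∑ n ∈ f.support, ‖f.coeff n‖ ^ 2 * (n.prod fun _ k => (k ! : ℝ)) : ℝ) : ℂ) = 0 := by
      rw [← h, fockInner]
      push_cast [Finsupp.prod]
      exact Finset.sum_congr rfl fun n _ => by rw [Complex.conj_mul']
    exact_mod_cast this
  have hpos : ∀ n : ι →₀ ℕ, 0 < (n.prod fun _ k => (k ! : ℝ)) := fun n =>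
    Finset.prod_pos fun i _ => by positivity
  rw [Finset.sum_eq_zero_iff_of_nonneg fun n _ => mul_nonneg (by positivity) (hpos n).le] at h'
  rw [← MvPolynomial.support_eq_empty, Finset.eq_empty_iff_forall_notMem]
  intro n hn
  have := h' n hn
  simp [(hpos n).ne', MvPolynomial.mem_support_iff.1 hn] at this

/-- Taking adjoints reverses the order of the factors; this is harmless because annihilators
commute. -/
theorem fockInner_mon_mul {S : ℕ} (k : Fin S → ι) (f g : Fock ι) :
    fockInner (mon k * f) g = fockInner f (annihilateMany k g) := by
  induction S generalizing g with
  | zero => simp [mon, annihilateMany]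
  | succ S ih =>
    have : mon k * f = create (k 0) (mon (fun s => k s.succ) * f) := by
      simp [mon_succ k, create, mul_assoc]
    rw [this, fockInner_create, ih, annihilateMany_succ, annihilateMany_annihilate]

theorem derivation_prod {α : Type*} [DecidableEq α] (D : Derivation ℂ (Fock ι) (Fock ι))
    (t : Finset α) (f : α → Fock ι) :
    D (∏ s ∈ t, f s) = ∑ a ∈ t, (∏ b ∈ t.erase a, f b) * D (f a) := by
  induction t using Finset.induction_on with
  | empty => simp
  | insert a t ha ih =>
    rw [Finset.prod_insert ha, Derivation.leibniz, ih, Finset.sum_insert ha,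
      Finset.erase_insert ha, add_comm, smul_eq_mul, smul_eq_mul, Finset.mul_sum]
    congr 1
    refine Finset.sum_congr rfl fun b hb => ?_
    have hab : a ≠ b := fun h => ha (h ▸ hb)
    rw [Finset.erase_insert_of_ne hab, Finset.prod_insert fun h => ha (Finset.mem_of_mem_erase h),
      mul_assoc]

/-- Exchanging slots `0` and `a` makes the remaining factors the tail of a tuple, in the convention
of `Equiv.Perm.decomposeFin`. -/
theorem prod_erase_X {N : ℕ} (j : Fin (N + 1) → ι) (a : Fin (N + 1)) :
    (∏ b ∈ Finset.univ.erase a, (MvPolynomial.X (j b) : Fock ι)) =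
      mon fun s : Fin N => j (Equiv.swap 0 a s.succ) := by
  refine mul_left_cancel₀ (MvPolynomial.X_ne_zero (R := ℂ) (j a)) ?_
  rw [Finset.mul_prod_erase _ (fun b => (MvPolynomial.X (j b) : Fock ι)) (Finset.mem_univ a),
    ← Equiv.prod_comp (Equiv.swap 0 a), Fin.prod_univ_succ]
  simp [mon]

theorem annihilate_mon [DecidableEq ι] {N : ℕ} (k : ι) (j : Fin (N + 1) → ι) :
    annihilate k (mon j) =
      ∑ a, if k = j a then mon (fun s : Fin N => j (Equiv.swap 0 a s.succ)) else 0 := by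
  change MvPolynomial.pderiv k (∏ s, (MvPolynomial.X (j s) : Fock ι)) = _
  rw [derivation_prod]
  refine Finset.sum_congr rfl fun a _ => ?_
  rw [prod_erase_X, MvPolynomial.pderiv_X, Pi.single_apply]
  simp [eq_comm]

/-- Wick's theorem for bosons: the annihilator of `i 0` removes one slot `a` of `j`, which becomes
the image of `0` under the permutation; the induction supplies the rest of the permutation. -/
theorem fockInner_mon [DecidableEq ι] {N : ℕ} (i j : Fin N → ι) :
    fockInner (mon i) (mon j) =
      ∑ σ : Equiv.Perm (Fin N), if i = j ∘ σ then (1 : ℂ) else 0 := by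
  induction N with
  | zero =>
    have : (1 : Fock ι) = MvPolynomial.monomial 0 1 := rfl
    have h : (1 : Fock ι).support = {0} := by
      rw [this, MvPolynomial.support_monomial, if_neg one_ne_zero]
    simp [mon, fockInner, h, Subsingleton.elim i j, eq_iff_true_of_subsingleton]
  | succ N ih =>
    rw [mon_succ i, fockInner_create, annihilate_mon, fockInner_sum_right,
      ← Equiv.sum_comp Equiv.Perm.decomposeFin.symm, Fintype.sum_prod_type]
    refine Finset.sum_congr rfl fun a _ => ?_
    by_cases h : i 0 = j a
    · rw [if_pos h, ih]
      refine Finset.sum_congr rfl fun π _ => if_congr ?_ rfl rfl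
      constructor
      · intro e
        funext x
        refine Fin.cases ?_ (fun x => ?_) x
        · simpa using h
        · simpa using congrFun e x
      · intro e
        funext x
        simpa using congrFun e x.succ
    · rw [if_neg h]
      symm
      rw [← fockInnerₗ_apply, map_zero]
      refine Finset.sum_eq_zero fun π _ => if_neg fun e => h ?_
      simpa using congrFun e 0

/-- The `N`-particle vectors of Fock space. -/
noncomputable def particles (ι : Type*) (N : ℕ) : Submodule ℂ (Fock ι) :=
  Submodule.span ℂ (Set.range (mon : (Fin N → ι) → Fock ι))

theorem mon_mem {N : ℕ} (i : Fin N → ι) : mon i ∈ particles ι N :=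
  Submodule.subset_span ⟨i, rfl⟩

theorem annihilate_mem {N : ℕ} (k : ι) {f : Fock ι} (hf : f ∈ particles ι (N + 1)) :
    annihilate k f ∈ particles ι N := by
  classical
  refine Submodule.span_induction ?_ (by simp) (fun x y _ _ hx hy => ?_) (fun a x _ hx => ?_) hf
  · rintro _ ⟨j, rfl⟩
    rw [annihilate_mon]
    refine Submodule.sum_mem _ fun a _ => ?_
    split_ifs
    · exact mon_mem _
    · simp
  · rw [map_add]
    exact add_mem hx hy
  · rw [map_smul]
    exact Submodule.smul_mem _ _ hx

theorem annihilate_eq_zero (k : ι) {f : Fock ι} (hf : f ∈ particles ι 0) : annihilate k f = 0 := by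
  refine Submodule.span_induction ?_ (by simp) (fun x y _ _ hx hy => ?_) (fun a x _ hx => ?_) hf
  · rintro _ ⟨j, rfl⟩
    simp [mon, annihilate]
  · rw [map_add, hx, hy, add_zero]
  · rw [map_smul, hx, smul_zero]

theorem annihilateMany_mem {S N K : ℕ} (h : N = S + K) (l : Fin S → ι) {f : Fock ι}
    (hf : f ∈ particles ι N) : annihilateMany l f ∈ particles ι K := by
  induction S generalizing K with
  | zero =>
    obtain rfl : N = K := by omega
    simpa [annihilateMany] using hf
  | succ S ih =>
    rw [annihilateMany_succ]
    exact annihilate_mem _ (ih (by omega) _)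

theorem annihilateMany_eq_zero {N : ℕ} (l : Fin (N + 1) → ι) {f : Fock ι}
    (hf : f ∈ particles ι N) : annihilateMany l f = 0 := by
  rw [annihilateMany_succ]
  exact annihilate_eq_zero _ (annihilateMany_mem rfl _ hf)

theorem eq_of_forall_fockInner_mon {K : ℕ} {f g : Fock ι} (hf : f ∈ particles ι K)
    (hg : g ∈ particles ι K) (h : ∀ r : Fin K → ι, fockInner (mon r) f = fockInner (mon r) g) :
    f = g := by
  rw [← sub_eq_zero]
  apply eq_zero_of_fockInner_self
  have key : ∀ x ∈ particles ι K, fockInner (f - g) x = 0 := by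
    intro x hx
    rw [← fockInnerₗ_apply]
    refine Submodule.span_induction ?_ (by simp) (fun x y _ _ hx hy => ?_) (fun a x _ hx => ?_) hx
    · rintro _ ⟨j, rfl⟩
      rw [fockInnerₗ_apply, ← fockInner_conj, ← fockInnerₗ_apply, map_sub, fockInnerₗ_apply,
        fockInnerₗ_apply, h, sub_self, map_zero]
    · rw [map_add, hx, hy, add_zero]
    · rw [map_smul, hx, smul_zero]
  exact key _ (sub_mem hf hg)

theorem eq_append_iff {S K : ℕ} {α : Type*} (i : Fin (S + K) → α) (k : Fin S → α)
    (r : Fin K → α) : i = Fin.append k r ↔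
      (fun s => i (Fin.castAdd K s)) = k ∧ (fun s => i (Fin.natAdd S s)) = r := by
  constructor
  · rintro rfl
    simp
  · rintro ⟨rfl, rfl⟩
    rw [Fin.append_castAdd_natAdd]

/-- The first `S` values of `σ` choose the slots that are annihilated. The order of the other `K`
slots is irrelevant, whence `1/K!`. Both sides are compared by their inner products with
`K`-particle monomials. -/
theorem annihilateMany_mon [DecidableEq ι] {S K : ℕ} (k : Fin S → ι) (i : Fin (S + K) → ι) :
    annihilateMany k (mon i) = ∑ σ : Equiv.Perm (Fin (S + K)),
      if (fun s => i (σ (Fin.castAdd K s))) = k then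
        (K ! : ℂ)⁻¹ • mon (fun s => i (σ (Fin.natAdd S s))) else 0 := by
  refine eq_of_forall_fockInner_mon (annihilateMany_mem rfl k (mon_mem i))
    (Submodule.sum_mem _ fun σ _ => ?_) fun r => ?_
  · split_ifs
    · exact Submodule.smul_mem _ _ (mon_mem _)
    · simp
  · rw [← fockInner_mon_mul, ← mon_append, fockInner_mon, fockInner_sum_right]
    have h1 : ∀ σ : Equiv.Perm (Fin (S + K)),
        fockInner (mon r) (if (fun s => i (σ (Fin.castAdd K s))) = k then
          (K ! : ℂ)⁻¹ • mon (fun s => i (σ (Fin.natAdd S s))) else 0) =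
        ∑ π : Equiv.Perm (Fin K), if (fun s => i (σ (Fin.castAdd K s))) = k ∧
          (fun s => i (σ (Fin.natAdd S (π s)))) = r then (K ! : ℂ)⁻¹ else 0 := by
      intro σ
      split_ifs with h
      · rw [fockInner_smul_right, fockInner_mon, Finset.mul_sum]
        refine Finset.sum_congr rfl fun π _ => ?_
        simp [h, eq_comm, Function.comp_def]
      · rw [← fockInnerₗ_apply, map_zero]
        simp [h]
    simp_rw [h1]
    rw [Finset.sum_comm]
    have h2 : ∀ π : Equiv.Perm (Fin K), (∑ σ : Equiv.Perm (Fin (S + K)),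
        if (fun s => i (σ (Fin.castAdd K s))) = k ∧
          (fun s => i (σ (Fin.natAdd S (π s)))) = r then (K ! : ℂ)⁻¹ else 0) =
        (K ! : ℂ)⁻¹ * ∑ σ : Equiv.Perm (Fin (S + K)),
          if Fin.append k r = i ∘ σ then (1 : ℂ) else 0 := by
      intro π
      -- A permutation `π` of the surviving slots is absorbed into `σ`, so all `K!` choices of `π`
      -- contribute equally.
      rw [Finset.mul_sum,
        ← Equiv.sum_comp (Equiv.mulRight (finSumFinEquiv.permCongr (Equiv.sumCongr 1 π)))
          fun σ : Equiv.Perm (Fin (S + K)) =>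
            (K ! : ℂ)⁻¹ * if Fin.append k r = i ∘ σ then (1 : ℂ) else 0]
      refine Finset.sum_congr rfl fun σ _ => ?_
      rw [mul_ite, mul_one, mul_zero]
      refine if_congr ?_ rfl rfl
      rw [eq_comm (a := Fin.append k r), eq_append_iff]
      simp [Equiv.permCongr_apply]
    simp_rw [h2]
    rw [Finset.sum_const, Finset.card_univ, Fintype.card_perm, Fintype.card_fin, nsmul_eq_mul,
      mul_inv_cancel_left₀ (by exact_mod_cast K.factorial_ne_zero)]

theorem ket_eq {N : ℕ} (i : Fin N → ι) :
    ket i = ((Real.sqrt (N ! : ℝ) : ℝ) : ℂ)⁻¹ • mon i := by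
  rw [ket, createMany_apply, vacuum, mul_one]

theorem sqrt_factorial_mul (N : ℕ) :
    ((Real.sqrt (N ! : ℝ) : ℝ) : ℂ)⁻¹ * ((Real.sqrt (N ! : ℝ) : ℝ) : ℂ)⁻¹ = (N ! : ℂ)⁻¹ := by
  rw [← mul_inv, ← Complex.ofReal_mul, Real.mul_self_sqrt (by positivity), Complex.ofReal_natCast]

theorem normalOrdered_eq_fockInner {S N : ℕ} (k l : Fin S → ι) (i j : Fin N → ι) :
    normalOrdered k l N i j =
      (N ! : ℂ)⁻¹ * fockInner (annihilateMany k (mon i)) (annihilateMany l (mon j)) := by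
  rw [normalOrdered, createMany_apply, ← fockInner_conj, fockInner_mon_mul, fockInner_conj,
    ket_eq, ket_eq, map_smul, map_smul, fockInner_smul_left, fockInner_smul_right, ← mul_assoc,
    map_inv₀, Complex.conj_ofReal, sqrt_factorial_mul]

theorem normalOrdered_eq_zero {N : ℕ} (k l : Fin (N + 1) → ι) :
    normalOrdered k l N = 0 := by
  funext i j
  rw [normalOrdered_eq_fockInner, annihilateMany_eq_zero l (mon_mem j), ← fockInnerₗ_apply,
    map_zero, mul_zero]
  rfl

theorem normalOrdered_eq_sum [DecidableEq ι] {S K : ℕ} (k l : Fin S → ι) (i j : Fin (S + K) → ι) :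
    normalOrdered k l (S + K) i j = ((S + K)! : ℂ)⁻¹ * (K ! : ℂ)⁻¹ *
      ∑ σ : Equiv.Perm (Fin (S + K)), ∑ τ : Equiv.Perm (Fin (S + K)),
        if (fun s => i (σ (Fin.castAdd K s))) = k ∧
          j ∘ τ = Fin.append l (fun s => i (σ (Fin.natAdd S s))) then (1 : ℂ) else 0 := by
  rw [normalOrdered_eq_fockInner, annihilateMany_mon k, fockInner_sum_left, mul_assoc,
    Finset.mul_sum (a := (K ! : ℂ)⁻¹)]
  congr 1
  refine Finset.sum_congr rfl fun σ _ => ?_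
  split_ifs with h
  · rw [fockInner_smul_left, ← fockInner_mon_mul, ← mon_append, fockInner_mon]
    simp [h, eq_comm]
  · rw [← fockInner_conj, ← fockInnerₗ_apply, map_zero]
    simp [h]

theorem annihilateState_pow_mon {N : ℕ} (c : ι → ℂ) (i : Fin N → ι) :
    (annihilateState c ^ N) (mon i) = MvPolynomial.C ((N ! : ℂ) * ∏ s, conj (c (i s))) := by
  classical
  induction N with
  | zero => simp [mon]
  | succ N ih =>
    have h : annihilateState c (mon i) = ∑ a, conj (c (i a)) •
        mon (fun s : Fin N => i (Equiv.swap 0 a s.succ)) := by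
      change MvPolynomial.mkDerivation ℂ _ (∏ s, (MvPolynomial.X (i s) : Fock ι)) = _
      rw [derivation_prod]
      refine Finset.sum_congr rfl fun a _ => ?_
      rw [prod_erase_X, MvPolynomial.mkDerivation_X, MvPolynomial.smul_eq_C_mul, mul_comm]
    rw [pow_succ, Module.End.mul_apply, h, map_sum]
    have h2 : ∀ a : Fin (N + 1), (annihilateState c ^ N) (conj (c (i a)) •
        mon (fun s : Fin N => i (Equiv.swap 0 a s.succ))) =
        MvPolynomial.C ((N ! : ℂ) * ∏ s, conj (c (i s))) := by
      intro a
      rw [map_smul, ih, MvPolynomial.smul_eq_C_mul, ← map_mul,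
        ← Equiv.prod_comp (Equiv.swap 0 a) fun s => conj (c (i s)), Fin.prod_univ_succ]
      congr 1
      simp only [Equiv.swap_apply_left]
      ring
    rw [Finset.sum_congr rfl fun a _ => h2 a, Finset.sum_const, Finset.card_univ,
      Fintype.card_fin, Nat.factorial_succ, ← map_nsmul]
    congr 1
    push_cast [nsmul_eq_mul]
    ring

theorem fockInner_C (a b : ℂ) :
    fockInner (MvPolynomial.C a : Fock ι) (MvPolynomial.C b) = conj a * b := by
  classical
  have h : (MvPolynomial.C a : Fock ι).support ⊆ {0} := by
    rw [← MvPolynomial.monomial_zero']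
    exact MvPolynomial.support_monomial_subset
  rw [fockInner_eq_sum _ _ h]
  simp

/-- The product state `∏ s, c (i s)`. -/
def power {N : ℕ} (c : ι → ℂ) (i : Fin N → ι) : ℂ := ∏ s, c (i s)

/-- The two powers of `a_Φ` each yield `N!`, which cancels the explicit `1/N!` and the two factors
`1/√N!` of the kets. -/
theorem pureProduct_eq (N : ℕ) (c : ι → ℂ) :
    pureProduct N c = fun i j => power c i * conj (power c j) := by
  funext i j
  rw [pureProduct, ket_eq, ket_eq, map_smul, map_smul, annihilateState_pow_mon,
    annihilateState_pow_mon, fockInner_smul_left, fockInner_smul_right, fockInner_C, map_inv₀,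
    Complex.conj_ofReal]
  have h := sqrt_factorial_mul N
  have hN : (N ! : ℂ) ≠ 0 := by exact_mod_cast N.factorial_ne_zero
  simp only [map_mul, map_prod, Complex.conj_conj, map_natCast, power]
  calc _ = (N ! : ℂ)⁻¹ * (((Real.sqrt (N ! : ℝ) : ℝ) : ℂ)⁻¹ * ((Real.sqrt (N ! : ℝ) : ℝ) : ℂ)⁻¹) *
        N ! * N ! * ((∏ s, c (i s)) * ∏ s, conj (c (j s))) := by ring
    _ = _ := by
      rw [h]
      field_simp

/-! ### Averages over permutations -/

/-- The sum over permutations does not depend on the base point `a₀`, so it can be averaged over all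
base points. -/
theorem card_mul_sum_perm {α : Type*} [Fintype α] [DecidableEq α] (f : α → ℂ) (a₀ : α) :
    (Fintype.card α : ℂ) * ∑ σ : Equiv.Perm α, f (σ a₀) =
      ((Fintype.card α)! : ℂ) * ∑ a, f a := by
  have h : ∀ a, ∑ σ : Equiv.Perm α, f (σ a) = ∑ σ : Equiv.Perm α, f (σ a₀) := fun a => by
    rw [← Equiv.sum_comp (Equiv.mulRight (Equiv.swap a a₀))]
    simp
  calc _ = ∑ a : α, ∑ σ : Equiv.Perm α, f (σ a) := by simp [h]
    _ = ∑ σ : Equiv.Perm α, ∑ a, f a := by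
      rw [Finset.sum_comm]
      exact Finset.sum_congr rfl fun σ _ => Equiv.sum_comp σ f
    _ = _ := by simp [Fintype.card_perm]

theorem card_mul_sum_perm₂ {α : Type*} [Fintype α] [DecidableEq α] (f : α → α → ℂ) {a₀ b₀ : α}
    (h₀ : a₀ ≠ b₀) :
    (Fintype.card α : ℂ) * ((Fintype.card α : ℂ) - 1) * ∑ σ : Equiv.Perm α, f (σ a₀) (σ b₀) =
      ((Fintype.card α)! : ℂ) * ∑ a, ∑ b, if a = b then 0 else f a b := by
  have h : ∀ a b, a ≠ b →
      ∑ σ : Equiv.Perm α, f (σ a) (σ b) = ∑ σ : Equiv.Perm α, f (σ a₀) (σ b₀) := by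
    intro a b hab
    have h1 : Equiv.swap a₀ a b₀ ≠ a := fun e =>
      h₀ ((Equiv.swap a₀ a).injective (by rw [e, Equiv.swap_apply_left]))
    -- This product of swaps sends `a₀` to `a` and `b₀` to `b`: the first swap places `a₀`, and the
    -- second moves the image of `b₀` while fixing `a`.
    rw [← Equiv.sum_comp (Equiv.mulRight (Equiv.swap (Equiv.swap a₀ a b₀) b * Equiv.swap a₀ a))
      fun σ : Equiv.Perm α => f (σ a₀) (σ b₀)]
    simp [Equiv.swap_apply_of_ne_of_ne h1.symm hab]
  have hc : ((Fintype.card α : ℂ) * ((Fintype.card α : ℂ) - 1)) =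
      ∑ a : α, ∑ b : α, if a = b then 0 else (1 : ℂ) := by
    have : ∀ a b : α, (if a = b then 0 else (1 : ℂ)) = 1 - if a = b then 1 else 0 := by
      intro a b
      split_ifs <;> simp
    simp [this, mul_sub]
  calc _ = ∑ a : α, ∑ b : α, if a = b then 0 else ∑ σ : Equiv.Perm α, f (σ a) (σ b) := by
        rw [hc, Finset.sum_mul]
        refine Finset.sum_congr rfl fun a _ => ?_
        rw [Finset.sum_mul]
        refine Finset.sum_congr rfl fun b _ => ?_
        split_ifs with hab
        · simp
        · rw [h a b hab, one_mul]
    _ = ∑ σ : Equiv.Perm α, ∑ a : α, ∑ b : α, if σ a = σ b then 0 else f (σ a) (σ b) := by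
      rw [Finset.sum_comm (s := (Finset.univ : Finset (Equiv.Perm α)))]
      refine Finset.sum_congr rfl fun a _ => ?_
      rw [Finset.sum_comm (s := (Finset.univ : Finset (Equiv.Perm α)))]
      refine Finset.sum_congr rfl fun b _ => ?_
      by_cases hab : a = b <;> simp [hab]
    _ = ∑ σ : Equiv.Perm α, ∑ a, ∑ b, if a = b then 0 else f a b := by
      refine Finset.sum_congr rfl fun σ _ => ?_
      rw [← Equiv.sum_comp σ fun a => ∑ b, if a = b then 0 else f a b]
      exact Finset.sum_congr rfl fun a _ =>
        Equiv.sum_comp σ fun b => if σ a = b then 0 else f (σ a) b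
    _ = _ := by simp [Fintype.card_perm]

/-! ### Second quantization -/

theorem power_append {S K : ℕ} (c : ι → ℂ) (k : Fin S → ι) (r : Fin K → ι) :
    power c (Fin.append k r) = power c k * power c r := by
  simp [power, Fin.prod_univ_add]

theorem power_comp_perm {N : ℕ} (c : ι → ℂ) (i : Fin N → ι) (σ : Equiv.Perm (Fin N)) :
    power c (i ∘ σ) = power c i := Equiv.prod_comp σ fun s => c (i s)

theorem secondQuantized_eq_zero {N : ℕ} (A : Op ι (N + 1)) : secondQuantized A N = 0 := by
  funext i j
  simp [secondQuantized, normalOrdered_eq_zero]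

/-- The Kronecker deltas collapse the sum over `p`. What remains are the choices `σ`, `τ` of the `S`
active particles on each side, with the spectators required to agree. -/
theorem secondQuantized_eq_sum [DecidableEq ι] {S K : ℕ} (A : Op ι S) (i j : Fin (S + K) → ι) :
    secondQuantized A (S + K) i j = (S ! : ℂ)⁻¹ * (((S + K)! : ℂ)⁻¹ * (K ! : ℂ)⁻¹ *
      ∑ σ : Equiv.Perm (Fin (S + K)), ∑ τ : Equiv.Perm (Fin (S + K)),
        if (fun s => j (τ (Fin.natAdd S s))) = (fun s => i (σ (Fin.natAdd S s))) then
          A (fun s => i (σ (Fin.castAdd K s))) (fun s => j (τ (Fin.castAdd K s))) else 0) := by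
  rw [secondQuantized]
  congr 1
  have h1 : ∀ p : (Fin S → ι) × (Fin S → ι), A p.1 p.2 * normalOrdered p.1 p.2 (S + K) i j =
      ∑ x : Equiv.Perm (Fin (S + K)) × Equiv.Perm (Fin (S + K)),
        if p = ((fun s => i (x.1 (Fin.castAdd K s))), fun s => j (x.2 (Fin.castAdd K s))) then
          ((S + K)! : ℂ)⁻¹ * (K ! : ℂ)⁻¹ *
            if (fun s => j (x.2 (Fin.natAdd S s))) = (fun s => i (x.1 (Fin.natAdd S s))) then
              A p.1 p.2 else 0 else 0 := by
    intro p
    rw [normalOrdered_eq_sum, Fintype.sum_prod_type, mul_left_comm, Finset.mul_sum, Finset.mul_sum]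
    refine Finset.sum_congr rfl fun σ _ => ?_
    rw [Finset.mul_sum, Finset.mul_sum]
    refine Finset.sum_congr rfl fun τ _ => ?_
    simp only [eq_append_iff, Prod.ext_iff, Function.comp_apply]
    by_cases h1 : (fun s => i (σ (Fin.castAdd K s))) = p.1 <;>
    by_cases h2 : (fun s => j (τ (Fin.castAdd K s))) = p.2 <;>
    simp [h1, h2, eq_comm (a := p.1), eq_comm (a := p.2)]
  simp_rw [h1]
  rw [finsum_sum_comm, Finset.mul_sum, Fintype.sum_prod_type]
  · refine Finset.sum_congr rfl fun σ _ => ?_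
    rw [Finset.mul_sum]
    refine Finset.sum_congr rfl fun τ _ => ?_
    rw [finsum_eq_single _ ((fun s => i (σ (Fin.castAdd K s))), fun s => j (τ (Fin.castAdd K s)))]
    · simp
    · intro p hp
      rw [if_neg hp]
  · intro x _
    refine Set.Finite.subset (Set.finite_singleton
      ((fun s => i (x.1 (Fin.castAdd K s))), fun s => j (x.2 (Fin.castAdd K s)))) fun p hp => ?_
    by_contra h
    exact hp (if_neg h)

/-- The matrix `A` is hermitian. -/
def IsHerm {N : ℕ} (A : Op ι N) : Prop := ∀ i j, conj (A i j) = A j i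

theorem IsHerm.add {N : ℕ} {A B : Op ι N} (hA : IsHerm A) (hB : IsHerm B) : IsHerm (A + B) :=
  fun i j => by simp [hA i j, hB i j]

theorem IsHerm.smul {N : ℕ} {A : Op ι N} (hA : IsHerm A) {a : ℂ} (ha : conj a = a) :
    IsHerm (a • A) := fun i j => by simp [hA i j, ha]

theorem IsHerm.secondQuantized {S K : ℕ} {A : Op ι S} (hA : IsHerm A) :
    IsHerm (secondQuantized A (S + K)) := by
  classical
  intro i j
  rw [secondQuantized_eq_sum, secondQuantized_eq_sum, Finset.sum_comm]
  simp only [map_mul, map_inv₀, map_natCast, map_sum, apply_ite conj, map_zero, hA _ _]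
  congr 2
  refine Finset.sum_congr rfl fun σ _ => Finset.sum_congr rfl fun τ _ => if_congr eq_comm rfl rfl

/-- The action of an `S`-particle operator on a product state of the one-particle state `c`, where
`v` is the image of the `S`-particle product state. -/
noncomputable def lift {S K : ℕ} (v : (Fin S → ι) → ℂ) (c : ι → ℂ) (i : Fin (S + K) → ι) : ℂ :=
  (S ! : ℂ)⁻¹ * ((K ! : ℂ)⁻¹ * ∑ σ : Equiv.Perm (Fin (S + K)),
    v (fun s => i (σ (Fin.castAdd K s))) * power c fun s => i (σ (Fin.natAdd S s)))

theorem hasSum_of_eq {α : Type*} {f g : α → ℂ} {a b : ℂ} (h : HasSum f a) (hf : ∀ x, g x = f x)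
    (hb : b = a) : HasSum g b := by
  rwa [funext hf, hb]

/-- Reindexing families of particles by a permutation. -/
def permEquiv {N : ℕ} (σ : Equiv.Perm (Fin N)) : (Fin N → ι) ≃ (Fin N → ι) :=
  Equiv.arrowCongr σ (Equiv.refl ι)

theorem permEquiv_apply {N : ℕ} (σ : Equiv.Perm (Fin N)) (i : Fin N → ι) :
    permEquiv σ i = i ∘ σ.symm := rfl

/-- For fixed `σ` and `τ` the spectator modes of `j` are pinned to those of `i`, and only the
`S`-particle sum `h` remains. The result does not depend on `τ`, because `power c` is symmetric. -/
theorem hasSum_secondQuantized {S K : ℕ} {A : Op ι S} {c : ι → ℂ} {v : (Fin S → ι) → ℂ}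
    (h : ∀ k, HasSum (fun l => A k l * power c l) (v k)) (i : Fin (S + K) → ι) :
    HasSum (fun j => secondQuantized A (S + K) i j * power c j) (lift v c i) := by
  classical
  have key : ∀ σ τ : Equiv.Perm (Fin (S + K)), HasSum (fun j : Fin (S + K) → ι =>
      (if (fun s => j (τ (Fin.natAdd S s))) = (fun s => i (σ (Fin.natAdd S s))) then
          A (fun s => i (σ (Fin.castAdd K s))) (fun s => j (τ (Fin.castAdd K s))) else 0) *
        power c j)
      (v (fun s => i (σ (Fin.castAdd K s))) * power c fun s => i (σ (Fin.natAdd S s))) := by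
    intro σ τ
    rw [← Equiv.hasSum_iff (permEquiv τ), ← Equiv.hasSum_iff (Fin.appendEquiv S K)]
    have hinj : Function.Injective fun l : Fin S → ι => (l, fun s => i (σ (Fin.natAdd S s))) :=
      fun l l' hl => (Prod.ext_iff.1 hl).1
    rw [← hinj.hasSum_iff]
    · refine hasSum_of_eq ((h (fun s => i (σ (Fin.castAdd K s)))).mul_right
        (power c fun s => i (σ (Fin.natAdd S s)))) (fun l => ?_) rfl
      simp only [Function.comp_apply, permEquiv_apply, power_comp_perm, Equiv.symm_apply_apply]
      simp [mul_assoc, ← power_append]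
      exact Or.inl rfl
    · rintro ⟨l, r⟩ hr
      have : r ≠ fun s => i (σ (Fin.natAdd S s)) := fun e => hr ⟨l, by rw [e]⟩
      simp [permEquiv_apply, this]
  have h2 := ((hasSum_sum fun σ (_ : σ ∈ Finset.univ) => hasSum_sum fun τ
    (_ : τ ∈ Finset.univ) => key σ τ).mul_left ((S ! : ℂ)⁻¹ * (((S + K)! : ℂ)⁻¹ * (K ! : ℂ)⁻¹)))
  refine hasSum_of_eq h2 (fun j => ?_) ?_
  · rw [secondQuantized_eq_sum]
    simp only [Finset.sum_mul, mul_assoc]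
  · simp only [lift, Finset.sum_const, Finset.card_univ, Fintype.card_perm, Fintype.card_fin,
      nsmul_eq_mul, ← Finset.mul_sum]
    have : ((S + K)! : ℂ) ≠ 0 := by exact_mod_cast (S + K).factorial_ne_zero
    field_simp

/-- The action of the one-particle operator with `c ↦ f` on the product state. -/
def lift₁ {N : ℕ} (f c : ι → ℂ) (i : Fin N → ι) : ℂ :=
  ∑ a, ∏ s, if s = a then f (i s) else c (i s)

/-- The action of the two-particle operator with `c ⊗ c ↦ W` on the product state. -/
noncomputable def lift₂ {N : ℕ} (W : ι → ι → ℂ) (c : ι → ℂ) (i : Fin N → ι) : ℂ :=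
  2⁻¹ * ∑ a, ∑ b, if a = b then 0 else
    W (i a) (i b) * ∏ s, if s = a ∨ s = b then 1 else c (i s)

theorem lift_one {K : ℕ} (f c : ι → ℂ) (i : Fin (1 + K) → ι) :
    lift (fun k : Fin 1 → ι => f (k 0)) c i = lift₁ f c i := by
  have h := card_mul_sum_perm (fun a : Fin (1 + K) => ∏ s, if s = a then f (i s) else c (i s))
    (Fin.castAdd K 0)
  have h2 : ∀ σ : Equiv.Perm (Fin (1 + K)),
      (∏ s, if s = σ (Fin.castAdd K 0) then f (i s) else c (i s)) =
        f (i (σ (Fin.castAdd K 0))) * power c fun s => i (σ (Fin.natAdd 1 s)) := by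
    intro σ
    rw [← Equiv.prod_comp σ, Fin.prod_univ_add]
    have : ∀ s : Fin K, Fin.natAdd 1 s ≠ Fin.castAdd K 0 := fun s e => by
      simpa using congrArg Fin.val e
    simp [this, power]
  simp only [h2] at h
  rw [lift, lift₁]
  have hK : (K ! : ℂ) ≠ 0 := by exact_mod_cast K.factorial_ne_zero
  have hK' : (1 : ℂ) + K ≠ 0 := by exact_mod_cast (by omega : 1 + K ≠ 0)
  have hf : ((1 + K)! : ℂ) = (1 + K) * K ! := by
    rw [add_comm 1 K, Nat.factorial_succ]
    push_cast
    ring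
  rw [Fintype.card_fin, hf] at h
  push_cast at h
  simp only [Nat.factorial_one, Nat.cast_one, inv_one, one_mul]
  rw [inv_mul_eq_iff_eq_mul₀ hK]
  refine mul_left_cancel₀ hK' ?_
  rw [h]
  ring

theorem lift_two {K : ℕ} (W : ι → ι → ℂ) (c : ι → ℂ) (i : Fin (2 + K) → ι) :
    lift (fun k : Fin 2 → ι => W (k 0) (k 1)) c i = lift₂ W c i := by
  have h := card_mul_sum_perm₂ (fun a b : Fin (2 + K) =>
    W (i a) (i b) * ∏ s, if s = a ∨ s = b then 1 else c (i s))
    (a₀ := Fin.castAdd K 0) (b₀ := Fin.castAdd K 1) (by simp [Fin.ext_iff])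
  have h2 : ∀ σ : Equiv.Perm (Fin (2 + K)),
      (∏ s, if s = σ (Fin.castAdd K 0) ∨ s = σ (Fin.castAdd K 1) then 1 else c (i s)) =
        power c fun s => i (σ (Fin.natAdd 2 s)) := by
    intro σ
    rw [← Equiv.prod_comp σ, Fin.prod_univ_add]
    have h0 : ∀ s : Fin K, Fin.natAdd 2 s ≠ Fin.castAdd K 0 := fun s e => by
      simpa using congrArg Fin.val e
    have h1 : ∀ s : Fin K, Fin.natAdd 2 s ≠ Fin.castAdd K 1 := fun s e => by
      have := congrArg Fin.val e
      simp at this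
      omega
    simp [h0, h1, power]
  simp only [h2] at h
  rw [lift, lift₂]
  have hK : (K ! : ℂ) ≠ 0 := by exact_mod_cast K.factorial_ne_zero
  have hK' : (2 : ℂ) + K ≠ 0 := by exact_mod_cast (by omega : 2 + K ≠ 0)
  have hK'' : (1 : ℂ) + K ≠ 0 := by exact_mod_cast (by omega : 1 + K ≠ 0)
  have hf : ((2 + K)! : ℂ) = (2 + K) * (1 + K) * K ! := by
    rw [add_comm 2 K, Nat.factorial_succ, Nat.factorial_succ]
    push_cast
    ring
  rw [Fintype.card_fin, hf] at h
  push_cast at h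
  rw [Nat.factorial_two, Nat.cast_two]
  congr 1
  rw [inv_mul_eq_iff_eq_mul₀ hK]
  refine mul_left_cancel₀ (mul_ne_zero hK' hK'') ?_
  linear_combination h

/-! ### Commutators with rank one operators -/

/-- Hermiticity makes the second product the conjugate of the first, so a single convergent action
controls both. -/
theorem commConverges_rankOne {N : ℕ} {A : Op ι N} (hA : IsHerm A) {u v : (Fin N → ι) → ℂ}
    (h : ∀ i, HasSum (fun l => A i l * u l) (v i)) :
    CommConverges A (fun i j => u i * conj (u j)) ∧
      comm A (fun i j => u i * conj (u j)) = fun i j => v i * conj (u j) - u i * conj (v j) := by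
  have h1 : ∀ i j, HasSum (fun l => A i l * (u l * conj (u j))) (v i * conj (u j)) := fun i j => by
    simpa [mul_assoc] using (h i).mul_right (conj (u j))
  have h2 : ∀ i j, HasSum (fun l => u i * conj (u l) * A l j) (u i * conj (v j)) := fun i j => by
    refine hasSum_of_eq ((Complex.hasSum_conj'.2 (h j)).mul_left (u i)) (fun l => ?_) rfl
    rw [map_mul, hA, mul_assoc, mul_comm (conj (u l))]
  refine ⟨fun i j => ⟨(h1 i j).summable, (h2 i j).summable⟩, ?_⟩
  funext i j
  exact congrArg₂ (· - ·) (h1 i j).tsum_eq (h2 i j).tsum_eq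

/-! ### Partial traces -/

theorem hasSum_normalOrdered_mul {M K : ℕ} {X : Op ι (M + K)}
    (hX : ∀ (σ : Equiv.Perm (Fin (M + K))) i j, X (i ∘ σ) j = X i j) (n m : Fin M → ι)
    (i j : Fin (M + K) → ι) [DecidableEq ι] :
    HasSum (fun l => normalOrdered n m (M + K) i l * X l j)
      ((K ! : ℂ)⁻¹ * ∑ σ : Equiv.Perm (Fin (M + K)),
        if (fun s => i (σ (Fin.castAdd K s))) = n then
          X (Fin.append m fun s => i (σ (Fin.natAdd M s))) j else 0) := by
  have key : ∀ σ τ : Equiv.Perm (Fin (M + K)), HasSum (fun l : Fin (M + K) → ι =>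
      (if (fun s => i (σ (Fin.castAdd K s))) = n ∧
        l ∘ τ = Fin.append m (fun s => i (σ (Fin.natAdd M s))) then (1 : ℂ) else 0) * X l j)
      (if (fun s => i (σ (Fin.castAdd K s))) = n then
          X (Fin.append m fun s => i (σ (Fin.natAdd M s))) j else 0) := by
    intro σ τ
    rw [← Equiv.hasSum_iff (permEquiv τ)]
    refine hasSum_of_eq (hasSum_single (Fin.append m fun s => i (σ (Fin.natAdd M s)))
      fun l hl => ?_) (fun l => rfl) ?_
    · have : permEquiv τ l ∘ τ = l := by
        funext s
        simp [permEquiv_apply]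
      simp [this, hl]
    · have : ∀ q : Fin (M + K) → ι, permEquiv τ q ∘ τ = q := fun q => by
        funext s
        simp [permEquiv_apply]
      rw [Function.comp_apply, this]
      simp [permEquiv_apply, hX]
  have h2 := (hasSum_sum fun σ (_ : σ ∈ Finset.univ) => hasSum_sum fun τ
    (_ : τ ∈ Finset.univ) => key σ τ).mul_left (((M + K)! : ℂ)⁻¹ * (K ! : ℂ)⁻¹)
  refine hasSum_of_eq h2 (fun l => ?_) ?_
  · rw [normalOrdered_eq_sum]
    simp only [Finset.sum_mul, mul_assoc]
  · simp only [Finset.sum_const, Finset.card_univ, Fintype.card_perm, Fintype.card_fin,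
      nsmul_eq_mul, ← Finset.mul_sum]
    have : ((M + K)! : ℂ) ≠ 0 := by exact_mod_cast (M + K).factorial_ne_zero
    field_simp

/-- For `X` symmetric in its row and column indices separately, the Fock-space definition reduces to
contracting the last `K` slots: the trace equals `(M+K)!/K!` times this contraction, which the
prefactor in `partialTrace` undoes. -/
theorem partialTrace_eq {M K : ℕ} {X : Op ι (M + K)} {Y : Op ι M}
    (hX : ∀ (σ : Equiv.Perm (Fin (M + K))) i j, X (i ∘ σ) j = X i j)
    (hX' : ∀ (σ : Equiv.Perm (Fin (M + K))) i j, X i (j ∘ σ) = X i j)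
    (hY : ∀ m n, HasSum (fun r : Fin K → ι => X (Fin.append m r) (Fin.append n r)) (Y m n)) :
    PartialTraceConverges (M + K) M X ∧ partialTrace (M + K) M X = Y := by
  classical
  have key : ∀ m n : Fin M → ι, HasSum (fun i => mulOp (normalOrdered n m (M + K)) X i i)
      (((M + K)! : ℂ) * (K ! : ℂ)⁻¹ * Y m n) := by
    intro m n
    have h1 : ∀ σ : Equiv.Perm (Fin (M + K)), HasSum (fun i : Fin (M + K) → ι =>
        if (fun s => i (σ (Fin.castAdd K s))) = n then
          X (Fin.append m fun s => i (σ (Fin.natAdd M s))) i else 0) (Y m n) := by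
      intro σ
      rw [← Equiv.hasSum_iff (permEquiv σ), ← Equiv.hasSum_iff (Fin.appendEquiv M K)]
      have hinj : Function.Injective fun r : Fin K → ι => (n, r) :=
        fun l l' hl => (Prod.ext_iff.1 hl).2
      rw [← hinj.hasSum_iff]
      · refine hasSum_of_eq (hY m n) (fun r => ?_) rfl
        simp [permEquiv_apply, hX']
        rfl
      · rintro ⟨l, r⟩ hr
        have : l ≠ n := fun e => hr ⟨r, by rw [e]⟩
        simp [permEquiv_apply, this]
    refine hasSum_of_eq ((hasSum_sum fun σ (_ : σ ∈ Finset.univ) => h1 σ).mul_left (K ! : ℂ)⁻¹)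
      (fun i => (hasSum_normalOrdered_mul hX n m i i).tsum_eq) ?_
    simp only [Finset.sum_const, Finset.card_univ, Fintype.card_perm, Fintype.card_fin,
      nsmul_eq_mul]
    ring
  refine ⟨fun m n => (key m n).summable, ?_⟩
  -- Second quantization on exactly `M` particles averages over permutations of both indices, so it
  -- returns `Y` because `Y` is symmetric.
  have hYs : ∀ (σ τ : Equiv.Perm (Fin M)) m n, Y (m ∘ σ) (n ∘ τ) = Y m n := by
    intro σ τ m n
    refine (hY (m ∘ σ) (n ∘ τ)).unique (hasSum_of_eq (hY m n) (fun r => ?_) rfl)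
    have h : ∀ (σ : Equiv.Perm (Fin M)) (m : Fin M → ι), Fin.append (m ∘ σ) r =
        Fin.append m r ∘ finSumFinEquiv.permCongr (Equiv.sumCongr σ 1) := by
      intro σ m
      symm
      rw [eq_append_iff]
      constructor <;> funext s <;> simp [Equiv.permCongr_apply]
    rw [h, h, hX, hX']
  have hM : (M ! : ℂ) ≠ 0 := by exact_mod_cast M.factorial_ne_zero
  have hK : (K ! : ℂ) ≠ 0 := by exact_mod_cast K.factorial_ne_zero
  have hN : ((M + K)! : ℂ) ≠ 0 := by exact_mod_cast (M + K).factorial_ne_zero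
  have hB : (fun m n : Fin M → ι => (((M + K) - M)! : ℂ) / ((M + K)! : ℂ) *
      trace (mulOp (normalOrdered n m (M + K)) X)) = Y := by
    funext m n
    rw [trace, (key m n).tsum_eq, Nat.add_sub_cancel_left]
    field_simp
  funext i j
  rw [partialTrace, hB]
  have h0 := secondQuantized_eq_sum (K := 0) Y i j
  have hs : ∀ σ τ : Equiv.Perm (Fin M),
      Y (fun s => i (σ (Fin.castAdd 0 s))) (fun s => j (τ (Fin.castAdd 0 s))) = Y i j :=
    fun σ τ => hYs σ τ i j
  refine h0.trans ?_
  simp only [eq_iff_true_of_subsingleton, if_true, Nat.add_zero, hs, Finset.sum_const,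
    Finset.card_univ, Fintype.card_perm, Fintype.card_fin, nsmul_eq_mul, Nat.factorial_zero,
    Nat.cast_one]
  field_simp

theorem partialTrace_eq_zero {N : ℕ} (X : Op ι N) :
    PartialTraceConverges N (N + 1) X ∧ partialTrace N (N + 1) X = 0 := by
  have h : ∀ m n : Fin (N + 1) → ι, mulOp (normalOrdered n m N) X = 0 := by
    intro m n
    funext i j
    simp [mulOp, normalOrdered_eq_zero]
  refine ⟨fun m n => by simp [h], ?_⟩
  funext i j
  simp [partialTrace, h, trace, secondQuantized]

theorem hasSum_power {K : ℕ} {c d : ι → ℂ} {a : ℂ} (h : HasSum (fun x => c x * conj (d x)) a) :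
    HasSum (fun r : Fin K → ι => power c r * conj (power d r)) (a ^ K) := by
  have hs : ∀ K : ℕ, Summable fun r : Fin K → ι => ‖power c r * conj (power d r)‖ := by
    intro K
    induction K with
    | zero => exact (hasSum_unique _).summable
    | succ K ih =>
      rw [← Equiv.summable_iff (Fin.consEquiv fun _ => ι)]
      refine (h.summable.norm.mul_of_nonneg ih (fun _ => norm_nonneg _)
        fun _ => norm_nonneg _).congr fun p => ?_
      simp only [Function.comp_apply, Fin.consEquiv_apply, power, Fin.prod_univ_succ,
        Fin.cons_zero, Fin.cons_succ, norm_mul, map_mul]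
      ring
  induction K with
  | zero => simp [power]
  | succ K ih =>
    rw [← Equiv.hasSum_iff (Fin.consEquiv fun _ => ι), pow_succ']
    have hp : Summable fun p : ι × (Fin K → ι) =>
        (c p.1 * conj (d p.1)) * (power c p.2 * conj (power d p.2)) :=
      summable_mul_of_summable_norm (f := fun x => c x * conj (d x))
        (g := fun r : Fin K → ι => power c r * conj (power d r)) h.summable.norm (hs K)
    refine hasSum_of_eq (h.mul ih hp)
      (fun p => ?_) rfl
    simp only [Function.comp_apply, Fin.consEquiv_apply, power, Fin.prod_univ_succ,
      Fin.cons_zero, Fin.cons_succ, map_mul]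
    ring

theorem partialTrace_pureProduct {M K : ℕ} {c : ι → ℂ}
    (hc : HasSum (fun x => c x * conj (c x)) 1) :
    PartialTraceConverges (M + K) M (pureProduct (M + K) c) ∧
      partialTrace (M + K) M (pureProduct (M + K) c) = pureProduct M c := by
  rw [pureProduct_eq, pureProduct_eq]
  refine partialTrace_eq (fun σ i j => ?_) (fun σ i j => ?_) fun m n => ?_
  · simp only [power_comp_perm]
  · simp only [power_comp_perm]
  · refine hasSum_of_eq ((hasSum_power (K := K) hc).mul_left (power c m * conj (power c n)))
      (fun r => ?_) (by simp)
    simp only [power_append, map_mul]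
    ring

/-! ### The symmetrized product of one-particle states -/

theorem pair_apply (f g : ℓ²(ι, ℂ)) (p : ι × ι) :
    pair f g p = (f p.1 * g p.2 + g p.1 * f p.2) / 2 := rfl

theorem pair_comm (f g : ℓ²(ι, ℂ)) : pair f g = pair g f := by
  ext p
  rw [pair_apply, pair_apply, add_comm]

theorem hasSum_norm_sq {α : Type*} (f : ℓ²(α, ℂ)) : HasSum (fun i => ‖f i‖ ^ 2) (‖f‖ ^ 2) := by
  have := lp.hasSum_norm (p := 2) (by norm_num) f
  simpa using this

theorem hasSum_mul_of_nonneg {α β : Type*} {u : α → ℝ} {v : β → ℝ} {a b : ℝ} (hu : HasSum u a)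
    (hv : HasSum v b) (hu' : ∀ x, 0 ≤ u x) (hv' : ∀ x, 0 ≤ v x) :
    HasSum (fun p : α × β => u p.1 * v p.2) (a * b) :=
  hu.mul hv (hu.summable.mul_of_nonneg hv.summable hu' hv')

theorem norm_pair_le (f g : ℓ²(ι, ℂ)) : ‖pair f g‖ ≤ 1 * ‖f‖ * ‖g‖ := by
  have h : ∀ f g : ℓ²(ι, ℂ), HasSum (fun p : ι × ι => ‖f p.1‖ ^ 2 * ‖g p.2‖ ^ 2)
      (‖f‖ ^ 2 * ‖g‖ ^ 2) := by
    intro f g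
    exact hasSum_mul_of_nonneg (u := fun i => ‖f i‖ ^ 2) (v := fun i => ‖g i‖ ^ 2)
      (hasSum_norm_sq f) (hasSum_norm_sq g) (fun _ => sq_nonneg _) fun _ => sq_nonneg _
  have h2 := ((h f g).add (h g f)).mul_left (1 / 2)
  have hle : ‖pair f g‖ ^ 2 ≤ (‖f‖ * ‖g‖) ^ 2 := by
    refine (hasSum_le (fun p => ?_) (hasSum_norm_sq (pair f g)) h2).trans_eq (by ring)
    rw [pair_apply, norm_div, Complex.norm_two]
    have := norm_add_le (f p.1 * g p.2) (g p.1 * f p.2)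
    rw [norm_mul, norm_mul] at this
    have h0 := norm_nonneg (f p.1 * g p.2 + g p.1 * f p.2)
    nlinarith [sq_nonneg (‖f p.1‖ * ‖g p.2‖ - ‖g p.1‖ * ‖f p.2‖)]
  rw [one_mul]
  exact (pow_le_pow_iff_left₀ (norm_nonneg _) (by positivity) two_ne_zero).1 hle

/-- The symmetrized product as a continuous bilinear map. -/
noncomputable def pairL (ι : Type*) : ℓ²(ι, ℂ) →L[ℂ] ℓ²(ι, ℂ) →L[ℂ] ℓ²(ι × ι, ℂ) :=
  LinearMap.mkContinuous₂ (LinearMap.mk₂ ℂ pair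
    (fun f f' g => by ext p; simp only [pair_apply, lp.coeFn_add, Pi.add_apply]; ring)
    (fun a f g => by
      ext p; simp only [pair_apply, lp.coeFn_smul, Pi.smul_apply, smul_eq_mul]; ring)
    (fun f g g' => by ext p; simp only [pair_apply, lp.coeFn_add, Pi.add_apply]; ring)
    (fun a f g => by
      ext p; simp only [pair_apply, lp.coeFn_smul, Pi.smul_apply, smul_eq_mul]; ring))
    1 norm_pair_le

theorem pairL_apply (f g : ℓ²(ι, ℂ)) : pairL ι f g = pair f g := rfl

theorem continuous_pair {Φ : ℝ → ℓ²(ι, ℂ)} (h : Continuous Φ) :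
    Continuous fun t => pair (Φ t) (Φ t) := by
  simp only [← pairL_apply]
  exact ((pairL ι).continuous.comp h).clm_apply h

theorem mode_apply [DecidableEq ι] (i j : ι) : mode i j = if j = i then 1 else 0 := by
  unfold mode
  simp only [lp.coeFn_single, Pi.single_apply]
  congr

theorem inner_mode_left (i : ι) (f : ℓ²(ι, ℂ)) : ⟪mode i, f⟫_ℂ = f i := by
  classical
  have := lp.inner_single_left (𝕜 := ℂ) (G := fun _ : ι => ℂ) i 1 f
  unfold mode
  simpa using this

theorem inner_pair_mode (a b : ι) (y : ℓ²(ι × ι, ℂ)) :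
    ⟪pair (mode a) (mode b), y⟫_ℂ = (y (a, b) + y (b, a)) / 2 := by
  classical
  have h := lp.hasSum_inner (𝕜 := ℂ) (pair (mode a) (mode b)) y
  have h1 := hasSum_single (f := fun p : ι × ι => if p = (a, b) then y p / 2 else 0) (a, b)
    fun p hp => if_neg hp
  have h2 := hasSum_single (f := fun p : ι × ι => if p = (b, a) then y p / 2 else 0) (b, a)
    fun p hp => if_neg hp
  refine h.unique (hasSum_of_eq (h1.add h2) (fun p => ?_) (by simp; ring))
  have hm : ∀ a b, (mode a p.1 * mode b p.2 : ℂ) = if p = (a, b) then 1 else 0 := by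
    intro a b
    simp only [mode_apply, Prod.ext_iff]
    split_ifs <;> simp_all
  rw [pair_apply, hm, hm]
  have h2c : conj (2 : ℂ) = 2 := map_ofNat (starRingEnd ℂ) 2
  split_ifs <;> simp [h2c] <;> ring

theorem hasSum_smul_mode (f : ℓ²(ι, ℂ)) : HasSum (fun i => f i • mode i) f := by
  classical
  have := lp.hasSum_single (E := fun _ : ι => ℂ) (p := 2) ENNReal.ofNat_ne_top f
  convert this using 2 with i
  ext j
  rw [lp.coeFn_smul, Pi.smul_apply, mode_apply]
  simp [Pi.single_apply]

/-- Continuity of the symmetrized product in one factor lets the mode expansion of `f` pass through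
the inner product with a fixed `y`. -/
theorem hasSum_inner_pair (y : ℓ²(ι × ι, ℂ)) (f g : ℓ²(ι, ℂ)) :
    HasSum (fun i => ⟪y, pair g (mode i)⟫_ℂ * f i) ⟪y, pair g f⟫_ℂ := by
  have := (hasSum_smul_mode f).mapL ((innerSL ℂ y).comp (pairL ι g))
  refine hasSum_of_eq this (fun i => ?_) rfl
  simp [pairL_apply, mul_comm]

theorem hasSum_inner_pair_conj (y : ℓ²(ι × ι, ℂ)) (f g : ℓ²(ι, ℂ)) :
    HasSum (fun i => ⟪pair g (mode i), y⟫_ℂ * conj (f i)) ⟪pair g f, y⟫_ℂ := by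
  refine hasSum_of_eq (Complex.hasSum_conj'.2 (hasSum_inner_pair y f g)) (fun i => ?_) ?_
  · rw [map_mul, inner_conj_symm]
  · rw [inner_conj_symm]

theorem hasSum_inner_pair_pair (y : ℓ²(ι × ι, ℂ)) (f : ℓ²(ι, ℂ)) :
    HasSum (fun p : ι × ι => ⟪y, pair (mode p.1) (mode p.2)⟫_ℂ * (f p.1 * f p.2))
      ⟪y, pair f f⟫_ℂ := by
  have h := lp.hasSum_inner (𝕜 := ℂ) y (pair f f)
  have h' := (Equiv.prodComm ι ι).hasSum_iff.2 h
  refine hasSum_of_eq ((h.add h').mul_left (1 / 2)) (fun p => ?_) (by ring)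
  rw [← inner_conj_symm, inner_pair_mode]
  simp only [Function.comp_apply, Equiv.prodComm_apply, RCLike.inner_apply, pair_apply,
    Prod.fst_swap, Prod.snd_swap, map_div₀, map_add, map_ofNat]
  have : p.swap = (p.2, p.1) := rfl
  rw [this]
  ring

/-! ### Hamiltonians acting on product states -/

namespace Hamiltonian

variable (H : Hamiltonian ι)

theorem isHerm_one : IsHerm H.one := fun i j => by
  rw [one, one, inner_conj_symm]
  exact H.symm1 ⟨mode (j 0), H.mode_mem _⟩ ⟨mode (i 0), H.mode_mem _⟩ |>.symm ▸ rfl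

theorem two_eq_inner_left (i j : Fin 2 → ι) : H.two i j =
    ⟪H.H2 ⟨pair (mode (i 0)) (mode (i 1)), H.pair_mem _ (H.mode_mem _) _ (H.mode_mem _)⟩,
      pair (mode (j 0)) (mode (j 1))⟫_ℂ := (H.symm2 ⟨_, _⟩ ⟨_, _⟩).symm

theorem isHerm_two : IsHerm H.two := fun i j => by
  rw [two, inner_conj_symm, two_eq_inner_left]

theorem hasSum_one {c : ℓ²(ι, ℂ)} (hc : c ∈ H.H1.domain) (k : Fin 1 → ι) :
    HasSum (fun l => H.one k l * power c l) (H.H1 ⟨c, hc⟩ (k 0)) := by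
  rw [← (Equiv.funUnique (Fin 1) ι).symm.hasSum_iff]
  refine hasSum_of_eq (lp.hasSum_inner (𝕜 := ℂ) (H.H1 ⟨mode (k 0), H.mode_mem _⟩) c)
    (fun m => ?_) ?_
  · have h : H.one k ((Equiv.funUnique (Fin 1) ι).symm m) =
        ⟪H.H1 ⟨mode (k 0), H.mode_mem _⟩, mode m⟫_ℂ :=
      (H.symm1 ⟨mode (k 0), H.mode_mem _⟩ ⟨mode m, H.mode_mem _⟩).symm
    rw [Function.comp_apply, h, ← inner_conj_symm, inner_mode_left]
    simp [power, mul_comm]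
  · rw [← inner_mode_left]
    exact (H.symm1 ⟨mode (k 0), H.mode_mem _⟩ ⟨c, hc⟩).symm

/-- The state `H2 (c ∨ c)`. -/
noncomputable def pairImage {c : ℓ²(ι, ℂ)} (hc : c ∈ H.H1.domain) : ℓ²(ι × ι, ℂ) :=
  H.H2 ⟨pair c c, H.pair_mem _ hc _ hc⟩

/-- The symmetric components of `H2 (c ∨ c)`. -/
noncomputable def pairAction {c : ℓ²(ι, ℂ)} (hc : c ∈ H.H1.domain) (a b : ι) : ℂ :=
  ⟪pair (mode a) (mode b), H.pairImage hc⟫_ℂ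

/-- The image of `c` under the mean-field potential of `c`. -/
noncomputable def meanAction {c : ℓ²(ι, ℂ)} (hc : c ∈ H.H1.domain) (a : ι) : ℂ :=
  ⟪pair (mode a) c, H.pairImage hc⟫_ℂ

theorem pairAction_comm {c : ℓ²(ι, ℂ)} (hc : c ∈ H.H1.domain) (a b : ι) :
    H.pairAction hc a b = H.pairAction hc b a := by
  rw [pairAction, pairAction, pair_comm]

/-- `H2` is moved onto the fixed mode pair, the inner product with `pair c c` is expanded, and `H2`
is moved back. -/
theorem hasSum_two {c : ℓ²(ι, ℂ)} (hc : c ∈ H.H1.domain) (k : Fin 2 → ι) :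
    HasSum (fun l => H.two k l * power c l) (H.pairAction hc (k 0) (k 1)) := by
  rw [← (finTwoArrowEquiv ι).symm.hasSum_iff]
  refine hasSum_of_eq (hasSum_inner_pair_pair
    (H.H2 ⟨pair (mode (k 0)) (mode (k 1)), H.pair_mem _ (H.mode_mem _) _ (H.mode_mem _)⟩) c)
    (fun p => ?_) ?_
  · rw [Function.comp_apply, two_eq_inner_left]
    simp [power]
  · exact (H.symm2 ⟨pair (mode (k 0)) (mode (k 1)), _⟩ ⟨pair c c, _⟩).symm

/-- Tracing one particle out of the interaction produces `meanAction`; `hasSum_meanField_mul`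
obtains the same function from the mean-field potential. This coincidence is what closes the
hierarchy. -/
theorem hasSum_pairAction {c : ℓ²(ι, ℂ)} (hc : c ∈ H.H1.domain) (a : ι) :
    HasSum (fun x => H.pairAction hc a x * conj (c x)) (H.meanAction hc a) :=
  hasSum_inner_pair_conj _ _ _

theorem hasSum_meanAction {c : ℓ²(ι, ℂ)} (hc : c ∈ H.H1.domain) :
    HasSum (fun x => H.meanAction hc x * conj (c x)) ⟪pair c c, H.pairImage hc⟫_ℂ := by
  refine hasSum_of_eq (hasSum_inner_pair_conj (H.pairImage hc) c c) (fun x => ?_) rfl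
  rw [meanAction, pair_comm]

theorem hasSum_one_conj {c : ℓ²(ι, ℂ)} (hc : c ∈ H.H1.domain) :
    HasSum (fun x => H.H1 ⟨c, hc⟩ x * conj (c x)) ⟪c, H.H1 ⟨c, hc⟩⟫_ℂ := by
  refine hasSum_of_eq (lp.hasSum_inner (𝕜 := ℂ) c (H.H1 ⟨c, hc⟩)) (fun x => ?_) rfl
  simp

theorem conj_inner_one {c : ℓ²(ι, ℂ)} (hc : c ∈ H.H1.domain) :
    conj ⟪c, H.H1 ⟨c, hc⟩⟫_ℂ = ⟪c, H.H1 ⟨c, hc⟩⟫_ℂ := by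
  rw [inner_conj_symm]
  exact H.symm1 ⟨c, hc⟩ ⟨c, hc⟩

theorem conj_inner_two {c : ℓ²(ι, ℂ)} (hc : c ∈ H.H1.domain) :
    conj ⟪pair c c, H.pairImage hc⟫_ℂ = ⟪pair c c, H.pairImage hc⟫_ℂ := by
  rw [inner_conj_symm]
  exact H.symm2 ⟨pair c c, H.pair_mem _ hc _ hc⟩ ⟨pair c c, H.pair_mem _ hc _ hc⟩

theorem hasSum_meanField_inner {c : ℓ²(ι, ℂ)} (hc : c ∈ H.H1.domain) (n m j : ι) :
    HasSum (fun i => H.two ![n, j] ![i, m] * (c i * conj (c j)))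
      (⟪pair (mode n) (mode j), H.H2 ⟨pair (mode m) c, H.pair_mem _ (H.mode_mem m) _ hc⟩⟫_ℂ *
        conj (c j)) := by
  have := (hasSum_inner_pair (H.H2 ⟨pair (mode n) (mode j),
    H.pair_mem _ (H.mode_mem n) _ (H.mode_mem j)⟩) c (mode m)).mul_right (conj (c j))
  refine hasSum_of_eq this (fun i => ?_) ?_
  · rw [two_eq_inner_left, pair_comm (mode m)]
    simp [mul_assoc]
  · congr 1
    exact (H.symm2 ⟨pair (mode n) (mode j), _⟩ ⟨pair (mode m) c, _⟩).symm

/-- The sum over `i` is evaluated with `H2` on the mode pair; then `H2` returns to `pair (mode m)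
c`, which stays fixed in the sum over `j`. This explains the iterated summation. -/
theorem hasSum_meanField {c : ℓ²(ι, ℂ)} (hc : c ∈ H.H1.domain) (n m : ι) :
    HasSum (fun j => ∑' i, H.two ![n, j] ![i, m] * (c i * conj (c j)))
      ⟪pair (mode n) c, H.H2 ⟨pair (mode m) c, H.pair_mem _ (H.mode_mem m) _ hc⟩⟫_ℂ :=
  hasSum_of_eq (hasSum_inner_pair_conj _ c (mode n))
    (fun j => (H.hasSum_meanField_inner hc n m j).tsum_eq) rfl

theorem meanFieldConverges {c : ℓ²(ι, ℂ)} (hc : c ∈ H.H1.domain) :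
    H.MeanFieldConverges fun i j => c (i 0) * conj (c (j 0)) := fun n m =>
  ⟨fun j => (H.hasSum_meanField_inner hc n m j).summable, (H.hasSum_meanField hc n m).summable⟩

theorem meanField_eq {c : ℓ²(ι, ℂ)} (hc : c ∈ H.H1.domain) (n m : Fin 1 → ι) :
    H.meanField (fun i j => c (i 0) * conj (c (j 0))) n m =
      ⟪pair (mode (n 0)) c,
        H.H2 ⟨pair (mode (m 0)) c, H.pair_mem _ (H.mode_mem _) _ hc⟩⟫_ℂ :=
  (H.hasSum_meanField hc (n 0) (m 0)).tsum_eq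

theorem meanField_eq' {c : ℓ²(ι, ℂ)} (hc : c ∈ H.H1.domain) (n m : Fin 1 → ι) :
    H.meanField (fun i j => c (i 0) * conj (c (j 0))) n m =
      ⟪H.H2 ⟨pair (mode (n 0)) c, H.pair_mem _ (H.mode_mem _) _ hc⟩, pair (mode (m 0)) c⟫_ℂ :=
  (H.meanField_eq hc n m).trans
    (H.symm2 ⟨pair (mode (n 0)) c, H.pair_mem _ (H.mode_mem _) _ hc⟩ ⟨pair (mode (m 0)) c, _⟩).symm

theorem isHerm_meanField {c : ℓ²(ι, ℂ)} (hc : c ∈ H.H1.domain) :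
    IsHerm (H.meanField fun i j => c (i 0) * conj (c (j 0))) := fun n m => by
  rw [H.meanField_eq hc n m, H.meanField_eq' hc m n, inner_conj_symm]

theorem hasSum_meanField_mul {c : ℓ²(ι, ℂ)} (hc : c ∈ H.H1.domain) (k : Fin 1 → ι) :
    HasSum (fun l => H.meanField (fun i j => c (i 0) * conj (c (j 0))) k l * power c l)
      (H.meanAction hc (k 0)) := by
  rw [← (Equiv.funUnique (Fin 1) ι).symm.hasSum_iff]
  refine hasSum_of_eq (hasSum_inner_pair
    (H.H2 ⟨pair (mode (k 0)) c, H.pair_mem _ (H.mode_mem _) _ hc⟩) c c) (fun m => ?_) ?_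
  · rw [Function.comp_apply, H.meanField_eq' hc, pair_comm c]
    simp [power]
  · exact (H.symm2 ⟨pair (mode (k 0)) c, _⟩ ⟨pair c c, _⟩).symm

end Hamiltonian

/-! ### Contraction of the last particle -/

/-- The configuration `i` with an additional particle in the mode `x`. -/
def adjoin {N : ℕ} (i : Fin N → ι) (x : ι) : Fin (N + 1) → ι := Fin.snoc (α := fun _ => ι) i x

@[simp]
theorem adjoin_castSucc {N : ℕ} (i : Fin N → ι) (x : ι) (s : Fin N) :
    adjoin i x s.castSucc = i s := by
  simp [adjoin]

@[simp]
theorem adjoin_last {N : ℕ} (i : Fin N → ι) (x : ι) : adjoin i x (Fin.last N) = x := by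
  simp [adjoin]

theorem append_eq_adjoin {N : ℕ} (i : Fin N → ι) (x : Fin 1 → ι) :
    Fin.append i x = adjoin i (x 0) := Fin.append_right_eq_snoc i x

theorem power_adjoin {N : ℕ} (c : ι → ℂ) (i : Fin N → ι) (x : ι) :
    power c (adjoin i x) = power c i * c x := by
  simp [power, Fin.prod_univ_castSucc]

theorem lift₁_eq {N : ℕ} (f c : ι → ℂ) (i : Fin N → ι) :
    lift₁ f c i = ∑ a, f (i a) * ∏ s, if s = a then 1 else c (i s) := by
  refine Finset.sum_congr rfl fun a _ => ?_
  rw [← Finset.mul_prod_erase _ _ (Finset.mem_univ a), ← Finset.mul_prod_erase _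
    (fun s => if s = a then (1 : ℂ) else c (i s)) (Finset.mem_univ a), if_pos rfl, if_pos rfl,
    one_mul]
  congr 1
  refine Finset.prod_congr rfl fun s hs => ?_
  rw [if_neg (Finset.ne_of_mem_erase hs), if_neg (Finset.ne_of_mem_erase hs)]

theorem lift₁_adjoin {N : ℕ} (f c : ι → ℂ) (i : Fin N → ι) (x : ι) :
    lift₁ f c (adjoin i x) = lift₁ f c i * c x + power c i * f x := by
  simp [lift₁, power, Fin.sum_univ_castSucc, Fin.prod_univ_castSucc, Finset.sum_mul,
    (Fin.castSucc_ne_last _).symm]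

/-- Pairs containing the new particle occur in both orders, which by symmetry of `W` cancels the
factor `1/2`. -/
theorem lift₂_adjoin {N : ℕ} {W : ι → ι → ℂ} (hW : ∀ a b, W a b = W b a) (c : ι → ℂ)
    (i : Fin N → ι) (x : ι) :
    lift₂ W c (adjoin i x) = lift₂ W c i * c x + lift₁ (fun y => W y x) c i := by
  have h1 : ∀ a : Fin N, (∑ b : Fin N, if a = b then 0 else W (i a) (i b) *
      ((∏ s, if s = a ∨ s = b then 1 else c (i s)) * c x)) =
      (∑ b : Fin N, if a = b then 0 else W (i a) (i b) *
        ∏ s, if s = a ∨ s = b then 1 else c (i s)) * c x := by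
    intro a
    rw [Finset.sum_mul]
    refine Finset.sum_congr rfl fun b _ => ?_
    split_ifs <;> ring
  rw [lift₁_eq, lift₂, lift₂]
  simp only [Fin.sum_univ_castSucc, Fin.prod_univ_castSucc, Fin.castSucc_inj, adjoin_castSucc,
    adjoin_last, (Fin.castSucc_ne_last _).symm, (Fin.castSucc_ne_last _), if_false, or_false,
    false_or, or_true, if_true, mul_one, h1, add_zero, hW x, Finset.sum_add_distrib,
    ← Finset.sum_mul]
  ring

theorem lift₂_comp_perm {N : ℕ} (W : ι → ι → ℂ) (c : ι → ℂ) (i : Fin N → ι)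
    (σ : Equiv.Perm (Fin N)) : lift₂ W c (i ∘ σ) = lift₂ W c i := by
  symm
  rw [lift₂, lift₂, ← Equiv.sum_comp σ]
  congr 1
  refine Finset.sum_congr rfl fun a _ => ?_
  rw [← Equiv.sum_comp σ]
  refine Finset.sum_congr rfl fun b _ => ?_
  rw [← Equiv.prod_comp σ fun s => if s = σ a ∨ s = σ b then 1 else c (i s)]
  simp

theorem hasSum_power_adjoin {N : ℕ} {c : ι → ℂ} (hc : HasSum (fun x => c x * conj (c x)) 1)
    (i : Fin N → ι) :
    HasSum (fun x => power c (adjoin i x) * conj (c x)) (power c i) := by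
  refine hasSum_of_eq (hc.mul_left (power c i)) (fun x => ?_) (mul_one _).symm
  rw [power_adjoin, mul_assoc]

theorem hasSum_lift₁_adjoin {N : ℕ} {c f : ι → ℂ} {a : ℂ}
    (hc : HasSum (fun x => c x * conj (c x)) 1) (hf : HasSum (fun x => f x * conj (c x)) a)
    (i : Fin N → ι) :
    HasSum (fun x => lift₁ f c (adjoin i x) * conj (c x)) (lift₁ f c i + a * power c i) := by
  refine hasSum_of_eq ((hc.mul_left (lift₁ f c i)).add (hf.mul_left (power c i))) (fun x => ?_)
    (by ring)
  rw [lift₁_adjoin]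
  ring

theorem hasSum_lift₂_adjoin {N : ℕ} {c g : ι → ℂ} {W : ι → ι → ℂ} (hW : ∀ a b, W a b = W b a)
    (hc : HasSum (fun x => c x * conj (c x)) 1)
    (hg : ∀ y, HasSum (fun x => W y x * conj (c x)) (g y)) (i : Fin N → ι) :
    HasSum (fun x => lift₂ W c (adjoin i x) * conj (c x)) (lift₂ W c i + lift₁ g c i) := by
  have h := hasSum_sum fun a (_ : a ∈ Finset.univ) =>
    (hg (i a)).mul_right (∏ s, if s = a then 1 else c (i s))
  refine hasSum_of_eq ((hc.mul_left (lift₂ W c i)).add h) (fun x => ?_)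
    (by rw [lift₁_eq, mul_one])
  rw [lift₂_adjoin hW, lift₁_eq, add_mul, Finset.sum_mul]
  congr 1
  · ring
  · exact Finset.sum_congr rfl fun a _ => by ring

/-! ### Closure of the hierarchy -/

theorem partialTrace_pureProduct_of_le {M N : ℕ} (h : M ≤ N) {c : ι → ℂ}
    (hc : HasSum (fun x => c x * conj (c x)) 1) :
    PartialTraceConverges N M (pureProduct N c) ∧
      partialTrace N M (pureProduct N c) = pureProduct M c := by
  obtain ⟨K, rfl⟩ := Nat.exists_eq_add_of_le h
  exact partialTrace_pureProduct hc

theorem pureProduct_one (c : ι → ℂ) :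
    pureProduct 1 c = fun i j => c (i 0) * conj (c (j 0)) := by
  simp [pureProduct_eq, power]

namespace Hamiltonian

variable (H : Hamiltonian ι) {c : ℓ²(ι, ℂ)} (hc : c ∈ H.H1.domain) {M : ℕ}

theorem hasSum_onePart (hM : 1 ≤ M) (i : Fin M → ι) :
    HasSum (fun l => H.onePart M i l * power c l) (lift₁ (H.H1 ⟨c, hc⟩) c i) := by
  obtain ⟨K, rfl⟩ := Nat.exists_eq_add_of_le hM
  exact lift_one (H.H1 ⟨c, hc⟩) c i ▸ hasSum_secondQuantized (H.hasSum_one hc) i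

theorem hasSum_meanFieldPart (hM : 1 ≤ M) (i : Fin M → ι) :
    HasSum (fun l => H.meanFieldPart (pureProduct 1 c) M i l * power c l)
      (lift₁ (H.meanAction hc) c i) := by
  obtain ⟨K, rfl⟩ := Nat.exists_eq_add_of_le hM
  rw [pureProduct_one]
  exact lift_one (H.meanAction hc) c i ▸ hasSum_secondQuantized (H.hasSum_meanField_mul hc) i

theorem hasSum_twoPart (hM : 1 ≤ M) (i : Fin M → ι) :
    HasSum (fun l => H.twoPart M i l * power c l) (lift₂ (H.pairAction hc) c i) := by
  obtain rfl | h : M = 1 ∨ 2 ≤ M := by omega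
  · refine hasSum_of_eq hasSum_zero (fun l => ?_) ?_
    · rw [twoPart, secondQuantized_eq_zero]
      simp
    · simp [lift₂]
  · obtain ⟨K, rfl⟩ := Nat.exists_eq_add_of_le h
    exact lift_two (H.pairAction hc) c i ▸ hasSum_secondQuantized (H.hasSum_two hc) i

theorem isHerm_onePart (hM : 1 ≤ M) : IsHerm (H.onePart M) := by
  obtain ⟨K, rfl⟩ := Nat.exists_eq_add_of_le hM
  exact H.isHerm_one.secondQuantized

theorem isHerm_meanFieldPart (hc : c ∈ H.H1.domain) (hM : 1 ≤ M) : IsHerm (H.meanFieldPart (pureProduct 1 c) M) := by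
  obtain ⟨K, rfl⟩ := Nat.exists_eq_add_of_le hM
  rw [pureProduct_one]
  exact (H.isHerm_meanField hc).secondQuantized

theorem isHerm_twoPart (hM : 1 ≤ M) : IsHerm (H.twoPart M) := by
  obtain rfl | h : M = 1 ∨ 2 ≤ M := by omega
  · rw [twoPart, secondQuantized_eq_zero]
    exact fun i j => by simp
  · obtain ⟨K, rfl⟩ := Nat.exists_eq_add_of_le h
    exact H.isHerm_two.secondQuantized

/-- The action of `H1 + H2 + a C` on the product state, where `C` is its mean-field potential. -/
noncomputable def truncatedAction (a : ℂ) (i : Fin M → ι) : ℂ :=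
  lift₁ (H.H1 ⟨c, hc⟩) c i + lift₂ (H.pairAction hc) c i + a * lift₁ (H.meanAction hc) c i

theorem comm_truncated (hM : 1 ≤ M) {a : ℂ} (ha : conj a = a) :
    comm (H.onePart M + H.twoPart M + a • H.meanFieldPart (pureProduct 1 c) M)
      (pureProduct M c) = fun i j => H.truncatedAction hc a i * conj (power c j) -
        power c i * conj (H.truncatedAction hc a j) := by
  rw [pureProduct_eq M]
  refine (commConverges_rankOne (((H.isHerm_onePart hM).add (H.isHerm_twoPart hM)).add
    ((H.isHerm_meanFieldPart hc hM).smul ha)) fun i => ?_).2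
  refine hasSum_of_eq (((H.hasSum_onePart hc hM i).add (H.hasSum_twoPart hc hM i)).add
    ((H.hasSum_meanFieldPart hc hM i).mul_left a)) (fun l => ?_) rfl
  simp only [Pi.add_apply, Pi.smul_apply, smul_eq_mul]
  ring

theorem comm_bbgky (hM : 1 ≤ M) {a : ℂ} (ha : conj a = a) :
    comm (H.onePart M + a • H.twoPart M) (pureProduct M c) = fun i j =>
      (lift₁ (H.H1 ⟨c, hc⟩) c i + a * lift₂ (H.pairAction hc) c i) * conj (power c j) -
        power c i * conj (lift₁ (H.H1 ⟨c, hc⟩) c j + a * lift₂ (H.pairAction hc) c j) := by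
  rw [pureProduct_eq M]
  refine (commConverges_rankOne ((H.isHerm_onePart hM).add ((H.isHerm_twoPart hM).smul ha))
    fun i => ?_).2
  refine hasSum_of_eq ((H.hasSum_onePart hc hM i).add ((H.hasSum_twoPart hc hM i).mul_left a))
    (fun l => ?_) rfl
  simp only [Pi.add_apply, Pi.smul_apply, smul_eq_mul]
  ring

theorem partialTrace_comm_twoPart (hc1 : HasSum (fun x => c x * conj (c x)) 1) :
    PartialTraceConverges (M + 1) M (comm (H.twoPart (M + 1)) (pureProduct (M + 1) c)) ∧
      partialTrace (M + 1) M (comm (H.twoPart (M + 1)) (pureProduct (M + 1) c)) = fun i j =>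
        (lift₂ (H.pairAction hc) c i + lift₁ (H.meanAction hc) c i) * conj (power c j) -
          power c i * conj (lift₂ (H.pairAction hc) c j + lift₁ (H.meanAction hc) c j) := by
  rw [pureProduct_eq, (commConverges_rankOne (H.isHerm_twoPart (Nat.le_add_left 1 M))
    (H.hasSum_twoPart hc (Nat.le_add_left 1 M))).2]
  refine partialTrace_eq (fun σ i j => ?_) (fun σ i j => ?_) fun m n => ?_
  · simp only [power_comp_perm, lift₂_comp_perm]
  · simp only [power_comp_perm, lift₂_comp_perm]
  · rw [← (Equiv.funUnique (Fin 1) ι).symm.hasSum_iff]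
    have h := fun m : Fin M → ι => hasSum_lift₂_adjoin (H.pairAction_comm hc) hc1
      (H.hasSum_pairAction hc) m
    refine hasSum_of_eq (((h m).mul_right (conj (power c n))).sub
      ((Complex.hasSum_conj'.2 (h n)).mul_left (power c m))) (fun x => ?_) rfl
    simp only [Function.comp_apply, append_eq_adjoin, power_adjoin, map_mul, Complex.conj_conj]
    simp only [Equiv.funUnique_symm_apply, uniqueElim_const]
    ring

theorem truncatedRHS_eq {N : ℕ} (hM : 1 ≤ M) (hN : M ≤ N)
    (hc1 : HasSum (fun x => c x * conj (c x)) 1) :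
    H.truncatedRHS M (pureProduct N c) = fun i j =>
      H.truncatedAction hc ((N : ℂ) - M) i * conj (power c j) -
        power c i * conj (H.truncatedAction hc ((N : ℂ) - M) j) := by
  rw [truncatedRHS, (partialTrace_pureProduct_of_le hN hc1).2,
    (partialTrace_pureProduct_of_le (hM.trans hN) hc1).2]
  exact H.comm_truncated hc hM (by simp)

theorem vonNeumannRHS_eq {N : ℕ} (hN : 1 ≤ N) :
    H.vonNeumannRHS (pureProduct N c) = fun i j =>
      H.truncatedAction hc 0 i * conj (power c j) - power c i * conj (H.truncatedAction hc 0 j) := by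
  rw [vonNeumannRHS, ← H.comm_truncated hc hN (map_zero _), zero_smul, add_zero]

/-- The traced commutator contributes `N-M` times both `H2` and `C`. For `M = N` its coefficient is
zero, so that case is split off. -/
theorem bbgkyRHS_eq (hc : c ∈ H.H1.domain) {N : ℕ} (hM : 1 ≤ M) (hN : M ≤ N)
    (hc1 : HasSum (fun x => c x * conj (c x)) 1) :
    H.bbgkyRHS M (pureProduct N c) = H.truncatedRHS M (pureProduct N c) := by
  rw [H.truncatedRHS_eq hc hM hN hc1, bbgkyRHS, (partialTrace_pureProduct_of_le hN hc1).2,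
    H.comm_bbgky hc hM (by simp)]
  funext i j
  obtain rfl | h := hN.eq_or_lt
  · simp [truncatedAction]
  · rw [(partialTrace_pureProduct_of_le h hc1).2, (H.partialTrace_comm_twoPart hc hc1).2]
    simp only [Pi.add_apply, Pi.smul_apply, smul_eq_mul, truncatedAction, map_add, map_sub,
      map_mul, map_one, Complex.conj_natCast]
    ring

end Hamiltonian

/-! ### Derivatives of product states -/

/-- Fixing `j = x` makes `Q` proportional to `u`; the diagonal entry at `x` makes the ratio real. -/
theorem exists_real_multiple {α : Type*} {u Q : α → ℂ} {x : α} (hx : u x ≠ 0)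
    (h : ∀ i j, Q i * conj (u j) = u i * conj (Q j)) :
    ∃ a : ℝ, ∀ i, Q i = a * u i := by
  have hx' : conj (u x) ≠ 0 := by simpa using hx
  have h1 : ∀ i, Q i = conj (Q x) / conj (u x) * u i := fun i => by
    rw [div_mul_eq_mul_div, eq_div_iff hx', h, mul_comm]
  have hreal : conj (conj (Q x) / conj (u x)) = conj (Q x) / conj (u x) := by
    rw [map_div₀, Complex.conj_conj, Complex.conj_conj, div_eq_iff hx]
    exact h1 x
  obtain ⟨a, ha⟩ := Complex.conj_eq_iff_real.1 hreal
  exact ⟨a, fun i => by rw [← ha]; exact h1 i⟩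

theorem hasDerivAt_conj {f : ℝ → ℂ} {f' : ℂ} {t : ℝ} (h : HasDerivAt f f' t) :
    HasDerivAt (fun s => conj (f s)) (conj f') t :=
  Complex.conjCLE.toContinuousLinearMap.hasFDerivAt.comp_hasDerivAt t h

theorem lift₁_eq_erase {N : ℕ} (f c : ι → ℂ) (i : Fin N → ι) :
    lift₁ f c i = ∑ a, (∏ s ∈ Finset.univ.erase a, c (i s)) * f (i a) := by
  refine Finset.sum_congr rfl fun a _ => ?_
  rw [← Finset.mul_prod_erase _ _ (Finset.mem_univ a), if_pos rfl, mul_comm]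
  congr 1
  exact Finset.prod_congr rfl fun s hs => by rw [if_neg (Finset.ne_of_mem_erase hs)]

theorem hasDerivAt_power {N : ℕ} {Φ : ℝ → ι → ℂ} {e : ι → ℂ} {t : ℝ}
    (h : ∀ i j, HasDerivAt (fun s => Φ s i * conj (Φ s j))
      (e i * conj (Φ t j) + Φ t i * conj (e j)) t) (i j : Fin N → ι) :
    HasDerivAt (fun s => power (Φ s) i * conj (power (Φ s) j))
      (lift₁ e (Φ t) i * conj (power (Φ t) j) + power (Φ t) i * conj (lift₁ e (Φ t) j)) t := by
  have h1 := HasDerivAt.fun_finsetProd (u := Finset.univ) fun a _ => h (i a) (j a)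
  have h2 : (fun s => power (Φ s) i * conj (power (Φ s) j)) =
      fun s => ∏ a, Φ s (i a) * conj (Φ s (j a)) := by
    funext s
    simp [power, Finset.prod_mul_distrib]
  rw [h2]
  refine h1.congr_deriv ?_
  symm
  rw [lift₁_eq_erase, lift₁_eq_erase, map_sum, Finset.sum_mul, Finset.mul_sum,
    ← Finset.sum_add_distrib]
  refine Finset.sum_congr rfl fun a _ => ?_
  simp only [power, map_prod, map_mul, smul_eq_mul, Finset.prod_mul_distrib]
  rw [← Finset.mul_prod_erase _ (fun s => conj (Φ t (j s))) (Finset.mem_univ a),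
    ← Finset.mul_prod_erase _ (fun s => Φ t (i s)) (Finset.mem_univ a)]
  ring

/-- The diagonal entry at `x, …, x` is a power of `|Φ_x|²`, and its root is differentiable since it
is nonzero at `t`. Replacing one `x` on each side by `i` and `j` and dividing by `|Φ_x|^(2N)`
isolates the one-particle density. -/
theorem differentiableAt_density {N : ℕ} {Φ : ℝ → ι → ℂ} {t : ℝ}
    (h : ∀ i j : Fin (N + 1) → ι,
      DifferentiableAt ℝ (fun s => power (Φ s) i * conj (power (Φ s) j)) t)
    {x : ι} (hx : Φ t x ≠ 0) (i j : ι) :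
    DifferentiableAt ℝ (fun s => Φ s i * conj (Φ s j)) t := by
  have h1 : DifferentiableAt ℝ (fun s => (Complex.normSq (Φ s x)) ^ (N + 1)) t := by
    have := Complex.reCLM.differentiableAt.comp t (h (fun _ => x) fun _ => x)
    refine this.congr_of_eventuallyEq (Filter.Eventually.of_forall fun s => ?_)
    simp only [power, Finset.prod_const, Finset.card_univ, Fintype.card_fin, Function.comp_apply,
      Complex.reCLM_apply, map_pow, ← mul_pow, Complex.mul_conj]
    rw [← Complex.ofReal_pow, Complex.ofReal_re]
  have hpos : Complex.normSq (Φ t x) ≠ 0 := by simpa using hx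
  have h2 : DifferentiableAt ℝ (fun s => Complex.normSq (Φ s x)) t := by
    have := h1.rpow_const (p := ((N + 1 : ℕ) : ℝ)⁻¹) (Or.inl (pow_ne_zero _ hpos))
    refine this.congr_of_eventuallyEq (Filter.Eventually.of_forall fun s => ?_)
    exact (Real.pow_rpow_inv_natCast (Complex.normSq_nonneg _) (Nat.succ_ne_zero N)).symm
  have h3 : DifferentiableAt ℝ (fun s => ((Complex.normSq (Φ s x) : ℝ) : ℂ) ^ N) t :=
    (Complex.ofRealCLM.differentiableAt.comp t h2).pow N
  have h4 := (h (Fin.cons i fun _ => x) (Fin.cons j fun _ => x)).div h3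
    (pow_ne_zero _ (Complex.ofReal_ne_zero.2 hpos))
  refine h4.congr_of_eventuallyEq ?_
  filter_upwards [h2.continuousAt.eventually_ne hpos] with s hs
  have hs' : ((Complex.normSq (Φ s x) : ℝ) : ℂ) ^ N ≠ 0 :=
    pow_ne_zero _ (Complex.ofReal_ne_zero.2 hs)
  rw [Pi.div_apply, eq_div_iff hs', ← Complex.mul_conj]
  simp only [power, Fin.prod_univ_succ, Fin.cons_zero, Fin.cons_succ, Finset.prod_const,
    Finset.card_univ, Fintype.card_fin, map_mul, map_pow]
  ring

/-- `Φ` itself may have an irregular phase, so `e` is only a derivative in a chosen gauge. The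
product form of the derivative comes from differentiating the rank-one identity `P_ij P_xx = P_ix
P_xj`, where `P_ij = Φ_i conj Φ_j`. -/
theorem exists_hasDerivAt_density {N : ℕ} {Φ : ℝ → ι → ℂ} {t : ℝ}
    (h : ∀ i j : Fin (N + 1) → ι,
      DifferentiableAt ℝ (fun s => power (Φ s) i * conj (power (Φ s) j)) t)
    {x : ι} (hx : Φ t x ≠ 0) :
    ∃ e : ι → ℂ, ∀ i j, HasDerivAt (fun s => Φ s i * conj (Φ s j))
      (e i * conj (Φ t j) + Φ t i * conj (e j)) t := by
  have hd : ∀ i j, ∃ d, HasDerivAt (fun s => Φ s i * conj (Φ s j)) d t := fun i j =>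
    ⟨_, (differentiableAt_density h hx i j).hasDerivAt⟩
  choose d hd using hd
  have hx' : conj (Φ t x) ≠ 0 := by simpa using hx
  have hconj : ∀ i j, conj (d i j) = d j i := fun i j => by
    refine (hasDerivAt_conj (hd i j)).unique ?_
    have h2 : (fun s => conj (Φ s i * conj (Φ s j))) = fun s => Φ s j * conj (Φ s i) := by
      funext s
      rw [map_mul, Complex.conj_conj, mul_comm]
    rw [h2]
    exact hd j i
  have hmul : ∀ i j, d i j * (Φ t x * conj (Φ t x)) + Φ t i * conj (Φ t j) * d x x =
      d i x * (Φ t x * conj (Φ t j)) + Φ t i * conj (Φ t x) * d x j := fun i j => by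
    refine ((hd i j).mul (hd x x)).unique ?_
    refine ((hd i x).mul (hd x j)).congr_of_eventuallyEq (Filter.Eventually.of_forall fun s => ?_)
    simp only [Pi.mul_apply]
    ring
  -- This is the derivative at `t` of `Φ` rephased so that its component `x` keeps the phase it has
  -- at time `t`.
  refine ⟨fun i => d i x / conj (Φ t x) - Φ t i * d x x / (2 * (Φ t x * conj (Φ t x))),
    fun i j => ?_⟩
  convert hd i j using 1
  simp only [map_sub, map_div₀, map_mul, hconj, Complex.conj_conj, map_ofNat]
  have := hmul i j
  field_simp
  linear_combination -2 * this

/-! ### Descent of the equation of motion to fewer particles -/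

namespace Hamiltonian

variable (H : Hamiltonian ι)

theorem truncatedAction_contract {c : ℓ²(ι, ℂ)} (hc : c ∈ H.H1.domain)
    (hc1 : HasSum (fun x => c x * conj (c x)) 1) {M : ℕ} (a : ℂ) (i : Fin M → ι) :
    HasSum (fun x => H.truncatedAction hc a (adjoin i x) * conj (c x))
      (H.truncatedAction hc (a + 1) i +
        (⟪c, H.H1 ⟨c, hc⟩⟫_ℂ + a * ⟪pair c c, H.pairImage hc⟫_ℂ) * power c i) := by
  have h := ((hasSum_lift₁_adjoin hc1 (H.hasSum_one_conj hc) i).add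
    (hasSum_lift₂_adjoin (H.pairAction_comm hc) hc1 (H.hasSum_pairAction hc) i)).add
    ((hasSum_lift₁_adjoin hc1 (H.hasSum_meanAction hc) i).mul_left a)
  refine hasSum_of_eq h (fun x => ?_) ?_ <;> simp only [truncatedAction] <;> ring

/-- Contraction of an equation `z D_e = F + a` for the derivatives of the `N`-particle product
state down to all particle numbers; the last identity at particle number zero forces all the
real phases. -/
theorem exists_truncatedAction_eq {c : ℓ²(ι, ℂ)} (hc : c ∈ H.H1.domain)
    (hc1 : HasSum (fun x => c x * conj (c x)) 1) {x₀ : ι} (hx₀ : c x₀ ≠ 0) {N : ℕ} {z : ℂ}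
    (hz : z ≠ 0) {e : ι → ℂ} {a : ℝ}
    (h : ∀ i : Fin (N + 1) → ι, z * lift₁ e c i = H.truncatedAction hc 0 i + a * power c i)
    {M : ℕ} (hM : M ≤ N + 1) :
    ∃ b : ℝ, ∀ i : Fin M → ι, z * lift₁ e c i =
      H.truncatedAction hc ((N + 1 : ℕ) - (M : ℂ)) i + b * power c i := by
  -- `e` is not known to lie in `ℓ²`. Summability against `conj c` is read off from the equation
  -- with all slots but the last at `x₀`, where `e x` has a nonzero coefficient.
  have hsum : Summable fun x => e x * conj (c x) := by
    have hp : power c (fun _ : Fin N => x₀) ≠ 0 := by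
      simpa [power] using fun h' => absurd h' hx₀
    have h1 := ((H.truncatedAction_contract hc hc1 0 fun _ : Fin N => x₀).add
      ((hasSum_power_adjoin hc1 fun _ : Fin N => x₀).mul_left (a : ℂ))).mul_left z⁻¹
    have h2 := (h1.sub (hc1.mul_left (lift₁ e c fun _ : Fin N => x₀))).mul_left
      (power c fun _ : Fin N => x₀)⁻¹
    refine h2.summable.congr fun x => ?_
    have h3 := h (adjoin (fun _ => x₀) x)
    rw [lift₁_adjoin] at h3
    have hzz : z⁻¹ * z = 1 := inv_mul_cancel₀ hz
    rw [inv_mul_eq_iff_eq_mul₀ hp]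
    linear_combination (-z⁻¹ * conj (c x)) * h3 +
      (lift₁ e c (fun _ : Fin N => x₀) * c x + power c (fun _ : Fin N => x₀) * e x) *
        conj (c x) * hzz
  obtain ⟨κ, hκ⟩ := hsum
  -- `K` counts the contracted slots. Each contraction adds to `b` real expectation values and
  -- subtracts `z * κ`.
  have key : ∀ K M : ℕ, M + K = N + 1 → ∃ b : ℂ, b.im = -(K * (z * κ).im) ∧
      ∀ i : Fin M → ι, z * lift₁ e c i = H.truncatedAction hc K i + b * power c i := by
    intro K
    induction K with
    | zero =>
      rintro M rfl
      exact ⟨a, by simp, by simpa using h⟩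
    | succ K ih =>
      intro M hMK
      obtain ⟨b, hb, hb'⟩ := ih (M + 1) (by omega)
      refine ⟨b + (⟪c, H.H1 ⟨c, hc⟩⟫_ℂ + K * ⟪pair c c, H.pairImage hc⟫_ℂ) - z * κ, ?_,
        fun i => ?_⟩
      · have h1 := Complex.conj_eq_iff_im.1 (H.conj_inner_one hc)
        have h2 := Complex.conj_eq_iff_im.1 (H.conj_inner_two hc)
        rw [Complex.sub_im, Complex.add_im, Complex.add_im, ← nsmul_eq_mul, Complex.smul_im, h1,
          h2, hb]
        push_cast
        simp only [smul_zero]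
        ring
      · have h1 := (hasSum_lift₁_adjoin hc1 hκ i).mul_left z
        have h2 := (H.truncatedAction_contract hc hc1 K i).add
          ((hasSum_power_adjoin hc1 i).mul_left b)
        have h3 := h1.unique (hasSum_of_eq h2 (fun x => ?_) rfl)
        · push_cast
          linear_combination h3
        · rw [← mul_assoc, hb']
          ring
  have him : (z * κ).im = 0 := by
    -- With no particles all actions are empty sums while `power` is one, so `b = 0` and the
    -- accumulated imaginary part vanishes.
    obtain ⟨b, hb, hb'⟩ := key (N + 1) 0 (by omega)
    have h0 := hb' Fin.elim0
    simp [lift₁, lift₂, truncatedAction, power] at h0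
    rw [← h0, Complex.zero_im, eq_comm, neg_eq_zero, mul_eq_zero] at hb
    exact hb.resolve_left (by exact_mod_cast N.succ_ne_zero)
  obtain ⟨K, hK⟩ := Nat.exists_eq_add_of_le hM
  obtain ⟨b, hb, hb'⟩ := key K M hK.symm
  rw [him, mul_zero, neg_zero] at hb
  obtain ⟨r, rfl⟩ := Complex.conj_eq_iff_real.1 (Complex.conj_eq_iff_im.2 hb)
  refine ⟨r, fun i => ?_⟩
  rw [hK, hb']
  congr 2
  push_cast
  ring

theorem conj_imaginary (ħ : ℝ) : conj (Complex.I * ħ) = -(Complex.I * ħ) := by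
  simp

theorem evolvesAt_truncated {Φ : ℝ → ℓ²(ι, ℂ)} (hdom : ∀ t, Φ t ∈ H.H1.domain)
    (hc1 : ∀ t, HasSum (fun x => Φ t x * conj (Φ t x)) 1) {ħ : ℝ} (hħ : 0 < ħ) {N M : ℕ}
    (hM : 1 ≤ M) (hN : M ≤ N) {t : ℝ}
    (h : EvolvesAt ħ (fun s => pureProduct N (Φ s)) t (H.vonNeumannRHS (pureProduct N (Φ t)))) :
    EvolvesAt ħ (fun s => pureProduct M (Φ s)) t (H.truncatedRHS M (pureProduct N (Φ t))) := by
  obtain ⟨x₀, hx₀⟩ : ∃ x, Φ t x ≠ 0 := by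
    by_contra! h0
    have := (hc1 t).unique (hasSum_of_eq hasSum_zero (fun x => by simp [h0]) rfl)
    exact one_ne_zero this
  obtain ⟨N, rfl⟩ : ∃ N', N = N' + 1 := ⟨N - 1, by omega⟩
  have hz : Complex.I * (ħ : ℂ) ≠ 0 :=
    mul_ne_zero Complex.I_ne_zero (Complex.ofReal_ne_zero.2 hħ.ne')
  rw [H.vonNeumannRHS_eq (hdom t) (by omega)] at h
  rw [H.truncatedRHS_eq (hdom t) hM hN (hc1 t)]
  simp only [EvolvesAt, pureProduct_eq] at h ⊢
  obtain ⟨e, he⟩ := exists_hasDerivAt_density (N := N) (Φ := fun s => Φ s) (t := t)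
    (fun i j => (h i j).choose_spec.1.differentiableAt) hx₀
  have hp : power (Φ t) (fun _ : Fin (N + 1) => x₀) ≠ 0 := by
    simpa [power] using hx₀
  -- Since `iħ` is anti-self-conjugate, the sum in the product rule becomes the difference required
  -- by the rank-one argument.
  obtain ⟨a, ha⟩ := exists_real_multiple (u := power (Φ t))
    (Q := fun i : Fin (N + 1) → ι => Complex.I * ħ * lift₁ e (Φ t) i -
      H.truncatedAction (hdom t) 0 i) hp fun i j => by
    obtain ⟨d, hd, hd'⟩ := h i j
    rw [hd.unique (hasDerivAt_power he i j)] at hd'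
    simp only [map_sub, map_mul (starRingEnd ℂ) (Complex.I * (ħ : ℂ)), conj_imaginary]
    linear_combination hd'
  obtain ⟨b, hb⟩ := H.exists_truncatedAction_eq (hdom t) (hc1 t) hx₀ hz
    (fun i => by rw [← ha]; ring) hN
  intro i j
  refine ⟨_, hasDerivAt_power he i j, ?_⟩
  have h1 := hb i
  have h2 := congrArg conj (hb j)
  rw [map_mul, conj_imaginary, map_add, map_mul, Complex.conj_ofReal] at h2
  linear_combination conj (power (Φ t) j) * h1 - power (Φ t) i * h2

end Hamiltonian

/-! ### The nonlinear Schrödinger equation -/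

theorem hasSum_mul_conj_of_norm {c : ℓ²(ι, ℂ)} (h : ‖c‖ = 1) :
    HasSum (fun x => c x * conj (c x)) 1 := by
  refine hasSum_of_eq (lp.hasSum_inner (𝕜 := ℂ) c c) (fun x => ?_) ?_
  · simp [Complex.mul_conj']
  · simp [inner_self_eq_norm_sq_to_K, h]

theorem hasDerivAt_apply {Φ : ℝ → ℓ²(ι, ℂ)} {Φ' : ℓ²(ι, ℂ)} {t : ℝ} (h : HasDerivAt Φ Φ' t)
    (n : ι) : HasDerivAt (fun s => Φ s n) (Φ' n) t := by
  have := ((innerSL ℂ (mode n)).restrictScalars ℝ).hasFDerivAt.comp_hasDerivAt t h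
  simpa only [Function.comp_def, ContinuousLinearMap.coe_restrictScalars', innerSL_apply_apply,
    inner_mode_left] using this

theorem hasDerivAt_pureProduct_one {Φ : ℝ → ℓ²(ι, ℂ)} {Φ' : ℓ²(ι, ℂ)} {t : ℝ}
    (h : HasDerivAt Φ Φ' t) (i j : Fin 1 → ι) :
    HasDerivAt (fun s => pureProduct 1 (Φ s) i j)
      (Φ' (i 0) * conj (Φ t (j 0)) + Φ t (i 0) * conj (Φ' (j 0))) t := by
  simp only [pureProduct_one]
  exact (hasDerivAt_apply h (i 0)).mul (hasDerivAt_conj (hasDerivAt_apply h (j 0)))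

namespace Hamiltonian

variable (H : Hamiltonian ι)

/-- The right-hand side `(H1 + (N-1) C) c` of the nonlinear Schrödinger equation. -/
noncomputable def effectiveAction (N : ℕ) {c : ℓ²(ι, ℂ)} (hc : c ∈ H.H1.domain) (n : ι) : ℂ :=
  H.H1 ⟨c, hc⟩ n + ((N : ℂ) - 1) * H.meanAction hc n

theorem hasSum_effective (N : ℕ) {c : ℓ²(ι, ℂ)} (hc : c ∈ H.H1.domain) (n : ι) :
    HasSum (fun m => H.effective N c ![n] ![m] * c m) (H.effectiveAction N hc n) := by
  have h := (H.hasSum_one hc ![n]).add ((H.hasSum_meanField_mul hc ![n]).mul_left ((N : ℂ) - 1))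
  rw [← (Equiv.funUnique (Fin 1) ι).symm.hasSum_iff] at h
  refine hasSum_of_eq h (fun m => ?_) rfl
  have hm : (Equiv.funUnique (Fin 1) ι).symm m = ![m] := by
    funext s
    rw [Subsingleton.elim s 0]
    rfl
  rw [Function.comp_apply, hm]
  simp only [effective, power, Pi.add_apply, Pi.smul_apply, smul_eq_mul]
  simp
  ring

theorem effective_phase (N : ℕ) (c : ι → ℂ) {z : ℂ} (hz : z * conj z = 1) :
    H.effective N (fun i => z * c i) = H.effective N c := by
  have : (fun i j : Fin 1 → ι => z * c (i 0) * conj (z * c (j 0))) =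
      fun i j => c (i 0) * conj (c (j 0)) := by
    funext i j
    rw [map_mul]
    linear_combination c (i 0) * conj (c (j 0)) * hz
  rw [effective, effective, this]

theorem truncatedRHS_one {c : ℓ²(ι, ℂ)} (hc : c ∈ H.H1.domain) {N : ℕ} (hN : 1 ≤ N)
    (hc1 : HasSum (fun x => c x * conj (c x)) 1) :
    H.truncatedRHS 1 (pureProduct N c) = fun i j =>
      H.effectiveAction N hc (i 0) * conj (c (j 0)) -
        c (i 0) * conj (H.effectiveAction N hc (j 0)) := by
  have h : ∀ i : Fin 1 → ι,
      H.truncatedAction hc ((N : ℂ) - (1 : ℕ)) i = H.effectiveAction N hc (i 0) := fun i => by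
    simp [truncatedAction, effectiveAction, lift₁, lift₂]
  rw [H.truncatedRHS_eq hc le_rfl hN hc1]
  simp only [h]
  simp [power]

theorem evolvesAt_of_solvesNLS {Φ : ℝ → ℓ²(ι, ℂ)} {t : ℝ} (hdom : Φ t ∈ H.H1.domain)
    (hc1 : HasSum (fun x => Φ t x * conj (Φ t x)) 1) {ħ : ℝ} {N : ℕ} (hN : 1 ≤ N)
    (h : H.SolvesNLS N ħ Φ t) :
    EvolvesAt ħ (fun s => pureProduct 1 (Φ s)) t (H.truncatedRHS 1 (pureProduct N (Φ t))) := by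
  obtain ⟨Φ', hΦ', hs⟩ := h
  rw [H.truncatedRHS_one hdom hN hc1]
  intro i j
  refine ⟨_, hasDerivAt_pureProduct_one hΦ' i j, ?_⟩
  have h1 := (hs (i 0)).trans (H.hasSum_effective N hdom (i 0)).tsum_eq
  have h2 := congrArg conj ((hs (j 0)).trans (H.hasSum_effective N hdom (j 0)).tsum_eq)
  rw [map_mul, conj_imaginary] at h2
  linear_combination conj (Φ t (j 0)) * h1 - Φ t (i 0) * h2

/-- The rate of change of the phase between a curve of product states that satisfies the equation
for the one-particle density operator and a solution of the nonlinear Schrödinger equation. -/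
noncomputable def phaseRate (N : ℕ) (ħ : ℝ) {c : ℓ²(ι, ℂ)} (hc : c ∈ H.H1.domain)
    (d : ℓ²(ι, ℂ)) : ℝ :=
  (Complex.I * ħ * ⟪c, d⟫_ℂ - (⟪c, H.H1 ⟨c, hc⟩⟫_ℂ +
    ((N : ℂ) - 1) * ⟪pair c c, H.pairImage hc⟫_ℂ)).re

/-- The rank-one argument gives a real multiple `a` of `Φ`; pairing with the unit vector `Φ`
identifies `a` with `phaseRate`. The explicit formula is needed for continuity in time. -/
theorem eq_phaseRate_of_evolvesAt {Φ : ℝ → ℓ²(ι, ℂ)} {t : ℝ} (hdom : Φ t ∈ H.H1.domain)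
    (hc1 : HasSum (fun x => Φ t x * conj (Φ t x)) 1) {ħ : ℝ} {N : ℕ} (hN : 1 ≤ N)
    {Φ' : ℓ²(ι, ℂ)} (hΦ' : HasDerivAt Φ Φ' t)
    (h : EvolvesAt ħ (fun s => pureProduct 1 (Φ s)) t (H.truncatedRHS 1 (pureProduct N (Φ t))))
    (n : ι) :
    Complex.I * ħ * Φ' n =
      H.effectiveAction N hdom n + H.phaseRate N ħ hdom Φ' * Φ t n := by
  obtain ⟨x₀, hx₀⟩ : ∃ x, Φ t x ≠ 0 := by
    by_contra! h0
    exact one_ne_zero (hc1.unique (hasSum_of_eq hasSum_zero (fun x => by simp [h0]) rfl))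
  rw [H.truncatedRHS_one hdom hN hc1] at h
  obtain ⟨a, ha⟩ := exists_real_multiple (u := Φ t)
    (Q := fun i => Complex.I * ħ * Φ' i - H.effectiveAction N hdom i) hx₀ fun i j => by
    obtain ⟨d, hd, hd'⟩ := h ![i] ![j]
    rw [hd.unique (hasDerivAt_pureProduct_one hΦ' _ _)] at hd'
    simp only [Matrix.cons_val_zero] at hd'
    simp only [map_sub, map_mul (starRingEnd ℂ) (Complex.I * (ħ : ℂ)), conj_imaginary]
    linear_combination hd'
  have hinner : HasSum (fun x => Φ' x * conj (Φ t x)) ⟪Φ t, Φ'⟫_ℂ := by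
    refine hasSum_of_eq (lp.hasSum_inner (𝕜 := ℂ) (Φ t) Φ') (fun x => ?_) rfl
    simp
  have h1 := (hinner.mul_left (Complex.I * (ħ : ℂ))).sub ((H.hasSum_one_conj hdom).add
    ((H.hasSum_meanAction hdom).mul_left ((N : ℂ) - 1)))
  have h2 := h1.unique (hasSum_of_eq (hc1.mul_left (a : ℂ)) (fun x => by
    have := ha x
    rw [effectiveAction] at this
    linear_combination conj (Φ t x) * this) rfl)
  have h3 : H.phaseRate N ħ hdom Φ' = a := by
    rw [phaseRate, h2, mul_one, Complex.ofReal_re]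
  rw [h3, ← ha]
  ring

theorem exp_mul_conj (θ : ℝ) :
    Complex.exp (θ * Complex.I) * conj (Complex.exp (θ * Complex.I)) = 1 := by
  rw [← Complex.exp_conj, ← Complex.exp_add]
  simp

/-- With `θ' = phaseRate / ħ`, the derivative of the exponential contributes `-phaseRate * Φ` to `iħ
∂(exp(iθ) Φ)`, up to the common phase, which cancels the surplus term. Continuity of the rate makes
its integral `C¹`. -/
theorem exists_phase {Φ : ℝ → ℓ²(ι, ℂ)} (hdom : ∀ t, Φ t ∈ H.H1.domain)
    (hc1 : ∀ t, HasSum (fun x => Φ t x * conj (Φ t x)) 1) {ħ : ℝ} (hħ : 0 < ħ) {N : ℕ}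
    (hN : 1 ≤ N) (hΦ : ContDiff ℝ 1 Φ) (h1 : Continuous fun t => H.H1 ⟨Φ t, hdom t⟩)
    (h2 : Continuous fun t => H.pairImage (hdom t))
    (h : ∀ t, EvolvesAt ħ (fun s => pureProduct 1 (Φ s)) t
      (H.truncatedRHS 1 (pureProduct N (Φ t)))) :
    ∃ θ : ℝ → ℝ, ContDiff ℝ 1 θ ∧
      ∀ t, H.SolvesNLS N ħ (fun s => Complex.exp (θ s * Complex.I) • Φ s) t := by
  have hcd : Continuous (deriv Φ) := hΦ.continuous_deriv le_rfl
  have hcμ : Continuous fun t => H.phaseRate N ħ (hdom t) (deriv Φ t) / ħ := by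
    have hp := continuous_pair hΦ.continuous
    unfold phaseRate
    exact (Complex.continuous_re.comp (((hΦ.continuous.inner hcd).const_mul _).sub
      ((hΦ.continuous.inner h1).add ((hp.inner h2).const_mul _)))).div_const _
  obtain ⟨θ, hθ⟩ : ∃ θ : ℝ → ℝ,
      ∀ t, HasDerivAt θ (H.phaseRate N ħ (hdom t) (deriv Φ t) / ħ) t :=
    ⟨_, fun t => (hcμ.integral_hasStrictDerivAt 0 t).hasDerivAt⟩
  refine ⟨θ, ?_, fun t => ?_⟩
  · rw [contDiff_one_iff_deriv]
    refine ⟨fun t => (hθ t).differentiableAt, ?_⟩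
    rwa [funext fun t => (hθ t).deriv]
  · have hd : HasDerivAt Φ (deriv Φ t) t := (hΦ.differentiable one_ne_zero t).hasDerivAt
    have he := ((hθ t).ofReal_comp.mul_const Complex.I).cexp
    refine ⟨_, he.smul hd, fun n => ?_⟩
    have hħ' : (ħ : ℂ) ≠ 0 := Complex.ofReal_ne_zero.2 hħ.ne'
    have hs := (H.hasSum_effective N (hdom t) n).mul_left (Complex.exp (θ t * Complex.I))
    have hs' : H.effective N (Complex.exp (θ t * Complex.I) • Φ t : ℓ²(ι, ℂ)) =
        H.effective N (Φ t) := H.effective_phase N (Φ t) (exp_mul_conj (θ t))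
    have hq := H.eq_phaseRate_of_evolvesAt (hdom t) (hc1 t) hN hd (h t) n
    symm
    refine (hasSum_of_eq hs (fun m => ?_) rfl).tsum_eq.trans ?_
    · rw [hs', lp.coeFn_smul, Pi.smul_apply, smul_eq_mul]
      ring
    · simp only [lp.coeFn_smul, lp.coeFn_add, Pi.add_apply, Pi.smul_apply, smul_eq_mul]
      push_cast
      field_simp
      linear_combination -hq -
        (H.phaseRate N ħ (hdom t) (deriv Φ t) : ℂ) * Φ t n * Complex.I_sq

end Hamiltonian

/-! ### The level above the top of the hierarchy, and the main theorem -/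

theorem commConverges_zero {M : ℕ} (A : Op ι M) : CommConverges A 0 ∧ comm A 0 = 0 := by
  refine ⟨fun i j => by simp, ?_⟩
  funext i j
  simp [comm, mulOp]

theorem partialTraceConverges_zero (N M : ℕ) : PartialTraceConverges N M (0 : Op ι N) :=
  fun m n => by simp [mulOp]

end BoseHierarchy

open BoseHierarchy in
theorem mainTheorem2 {ι : Type*} (H : Hamiltonian ι) (ħ : ℝ) (hħ : 0 < ħ) (N : ℕ)
    (Φ : ℝ → ℓ²(ι, ℂ)) (hnorm : ∀ t, ‖Φ t‖ = 1) (hdom : ∀ t, Φ t ∈ H.H1.domain)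
    (ρ : ℝ → Op ι N) (hρ : ∀ t, ρ t = pureProduct N (Φ t)) :
    -- every series in the equations below converges
    (∀ t, (1 ≤ N → H.MeanFieldConverges (partialTrace N 1 (ρ t))) ∧
      (1 ≤ N → ∀ n, Summable fun m => H.effective N (Φ t) ![n] ![m] * Φ t m) ∧
      ∀ M, 1 ≤ M → M ≤ N →
        CommConverges (H.onePart M) (partialTrace N M (ρ t)) ∧
        CommConverges (H.twoPart M) (partialTrace N M (ρ t)) ∧
        CommConverges (H.meanFieldPart (partialTrace N 1 (ρ t)) M) (partialTrace N M (ρ t)) ∧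
        CommConverges (H.twoPart (M + 1)) (partialTrace N (M + 1) (ρ t)) ∧
        PartialTraceConverges N M (ρ t) ∧
        PartialTraceConverges N (M + 1) (ρ t) ∧
        PartialTraceConverges (M + 1) M
          (comm (H.twoPart (M + 1)) (partialTrace N (M + 1) (ρ t)))) ∧
    -- closure of the hierarchy
    (∀ M, 1 ≤ M → M ≤ N → ∀ t,
      H.bbgkyRHS M (ρ t) = H.truncatedRHS M (ρ t) ∧
      (EvolvesAt ħ (fun s => partialTrace N M (ρ s)) t (H.bbgkyRHS M (ρ t)) ↔
        EvolvesAt ħ (fun s => partialTrace N M (ρ s)) t (H.truncatedRHS M (ρ t))) ∧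
      (EvolvesAt ħ ρ t (H.vonNeumannRHS (ρ t)) →
        EvolvesAt ħ (fun s => partialTrace N M (ρ s)) t (H.truncatedRHS M (ρ t)))) ∧
    -- one particle: equivalence with the nonlinear Schrödinger equation
    (1 ≤ N →
      (∀ t, partialTrace N 1 (ρ t) = fun i j => Φ t (i 0) * (starRingEnd ℂ) (Φ t (j 0))) ∧
      (∀ t, H.SolvesNLS N ħ Φ t →
        EvolvesAt ħ (fun s => partialTrace N 1 (ρ s)) t (H.truncatedRHS 1 (ρ t))) ∧
      (ContDiff ℝ 1 Φ →
        Continuous (fun t => H.H1 ⟨Φ t, hdom t⟩) →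
        Continuous (fun t => H.H2 ⟨pair (Φ t) (Φ t), H.pair_mem _ (hdom t) _ (hdom t)⟩) →
        ((∀ t, EvolvesAt ħ (fun s => partialTrace N 1 (ρ s)) t (H.truncatedRHS 1 (ρ t))) ↔
          ∃ θ : ℝ → ℝ, ContDiff ℝ 1 θ ∧
            ∀ t, H.SolvesNLS N ħ (fun s => Complex.exp (θ s * Complex.I) • Φ s) t))) := by
  obtain rfl : ρ = fun t => pureProduct N (Φ t) := funext hρ
  have hc1 : ∀ t, HasSum (fun x => Φ t x * conj (Φ t x)) 1 :=
    fun t => hasSum_mul_conj_of_norm (hnorm t)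
  have htr : ∀ {M}, M ≤ N → ∀ t, partialTrace N M (pureProduct N (Φ t)) = pureProduct M (Φ t) :=
    fun hM t => (partialTrace_pureProduct_of_le hM (hc1 t)).2
  refine ⟨fun t => ⟨fun hN => ?_, fun _ n => (H.hasSum_effective N (hdom t) n).summable,
    fun M hM hN => ?_⟩, fun M hM hN t => ⟨?_, ?_, fun h => ?_⟩, fun hN => ⟨fun t => ?_,
    fun t h => ?_, fun hΦ h1 h2 => ⟨fun h => ?_, ?_⟩⟩⟩
  · rw [htr hN, pureProduct_one]
    exact H.meanFieldConverges (hdom t)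
  · have hrank : ∀ {K : ℕ} {A : Op ι K} {v : (Fin K → ι) → ℂ}, IsHerm A →
        (∀ i, HasSum (fun l => A i l * power (Φ t) l) (v i)) →
        CommConverges A (pureProduct K (Φ t)) := fun hA h => by
      rw [pureProduct_eq]
      exact (commConverges_rankOne hA h).1
    have hnext : CommConverges (H.twoPart (M + 1)) (partialTrace N (M + 1) (pureProduct N (Φ t))) ∧
        PartialTraceConverges N (M + 1) (pureProduct N (Φ t)) ∧
        PartialTraceConverges (M + 1) M
          (comm (H.twoPart (M + 1)) (partialTrace N (M + 1) (pureProduct N (Φ t)))) := by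
      -- For `M = N` the formal `ρ^(N+1)` is zero, as `N + 1` annihilators kill every `N`-particle
      -- state.
      obtain rfl | hlt := hN.eq_or_lt
      · rw [(partialTrace_eq_zero _).2, (commConverges_zero _).2]
        exact ⟨(commConverges_zero _).1, (partialTrace_eq_zero _).1, partialTraceConverges_zero _ _⟩
      · rw [htr hlt]
        exact ⟨hrank (H.isHerm_twoPart (by omega)) (H.hasSum_twoPart (hdom t) (by omega)),
          (partialTrace_pureProduct_of_le hlt (hc1 t)).1,
          (H.partialTrace_comm_twoPart (hdom t) (hc1 t)).1⟩
    refine ⟨?_, ?_, ?_, hnext.1, (partialTrace_pureProduct_of_le hN (hc1 t)).1, hnext.2⟩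
    · rw [htr hN]
      exact hrank (H.isHerm_onePart hM) (H.hasSum_onePart (hdom t) hM)
    · rw [htr hN]
      exact hrank (H.isHerm_twoPart hM) (H.hasSum_twoPart (hdom t) hM)
    · rw [htr hN, htr (hM.trans hN)]
      exact hrank (H.isHerm_meanFieldPart (hdom t) hM) (H.hasSum_meanFieldPart (hdom t) hM)
  · exact H.bbgkyRHS_eq (hdom t) hM hN (hc1 t)
  · rw [H.bbgkyRHS_eq (hdom t) hM hN (hc1 t)]
  · simp only [htr hN]
    exact H.evolvesAt_truncated hdom hc1 hħ hM hN h
  · rw [htr hN, pureProduct_one]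
  · simp only [htr hN]
    exact H.evolvesAt_of_solvesNLS (hdom t) (hc1 t) hN h
  · simp only [htr hN] at h
    exact H.exists_phase hdom hc1 hħ hN hΦ h1 h2 h
  · rintro ⟨θ, -, hθ⟩ t
    simp only [htr hN]
    -- Product density operators are insensitive to the phase, so the equation derived for the
    -- rephased curve is already the one for `Φ`.
    have hphase : ∀ K s, pureProduct K (Complex.exp (θ s * Complex.I) • Φ s : ℓ²(ι, ℂ)) =
        pureProduct K (Φ s) := fun K s => by
      rw [pureProduct_eq, pureProduct_eq]
      funext i j
      have hp : ∀ i : Fin K → ι, power (Complex.exp (θ s * Complex.I) • Φ s : ℓ²(ι, ℂ)) i =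
          Complex.exp (θ s * Complex.I) ^ K * power (Φ s) i := fun i => by
        simp [power, Finset.prod_mul_distrib]
      have hpow : Complex.exp (θ s * Complex.I) ^ K *
          conj (Complex.exp (θ s * Complex.I) ^ K) = 1 := by
        rw [map_pow, ← mul_pow, Hamiltonian.exp_mul_conj, one_pow]
      rw [hp, hp, map_mul]
      linear_combination power (Φ s) i * conj (power (Φ s) j) * hpow
    have := H.evolvesAt_of_solvesNLS (H.H1.domain.smul_mem _ (hdom t))
      (hasSum_mul_conj_of_norm (by rw [norm_smul, Complex.norm_exp_ofReal_mul_I, hnorm, one_mul]))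
      hN (hθ t)
    simpa only [hphase] using this
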